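/- **Model categories.** Throughout, a *model category* $\mathcal C$ is a complete and cocomplete category with a zero object $0$ and a cofibrantly generated, proper model structure such that: the projections $X\leftarrow X\times Y\to Y$ are always fibrations; if $f\colon A\to B$ and $g\colon C\to D$ are acyclic fibrations, then $f\times g\colon A\times C\to B\times D$ is a weak equivalence; and if $f$ and $g$ are acyclic cofibrations, then $f\amalg g\colon A\amalg C\to B\amalg D$ is a weak equivalence. For a small category $\mathcal D$, the *projective* model structure on the functor category $[\mathcal D^{\mathrm{op}},\mathcal C]$ is the one whose fibrations and weak equivalences are the natural transformations that are objectwise fibrations, respectively objectwise weak equivalences. An adjunction $(\mathcal L,\mathcal R)$, with $\mathcal L$ the left adjoint, between categories with model structures is a *Quillen pair* if $\mathcal L$ preserves cofibrations and acyclic cofibrations. **Conjugate pairs.** An *indexing category* is a small category $\mathcal I$ with pullbacks in which every endomorphism is an isomorphism and in which each comma category $\mathcal I\downarrow a$ has a skeleton with finitely many objects. Let $\mathcal U$ be a small category and let $\mathcal I,\mathcal A$ be subcategories with the same objects as $\mathcal U$, where $\mathcal I$ is an indexing category, every isomorphism of $\mathcal I$ is an isomorphism of $\mathcal A$, and every map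 of $\mathcal U$ has the form $i\circ\alpha$ with $\alpha\in\mathcal A$ and $i\in\mathcal I$. The factorization $\mathcal U=\mathcal I\circ\mathcal A$ *admits conjugation* if: 1. whenever $i\circ\alpha=j\circ\beta$ with $\alpha\colon a\to b$, $\beta\colon a\to c$ in $\mathcal A$ and $i\colon b\to d$, $j\colon c\to d$ in $\mathcal I$, there is an isomorphism $e\colon c\to b$ of $\mathcal I$ with $e\beta=\alpha$ and $ie=j$; 2. for all $\alpha\colon a\to b$ in $\mathcal A$ and $i\colon c\to b$ in $\mathcal I$ there is a pullback square in $\mathcal U$ with $\alpha i'=i\alpha'$, where $i'\colon p\to a$ is in $\mathcal I$ and $\alpha'\colon p\to c$ is in $\mathcal A$, and the canonical isomorphism between two such pullbacks is an isomorphism of $\mathcal I$. Then $\mathcal I\circ\mathcal A\circ\mathcal I^{\mathrm{op}}$ denotes the category with the objects of $\mathcal U$ whose maps $a\to b$ are equivalence classes, written $j\circ\alpha\circ i^*$, of diagrams $a\xleftarrow{i}a_1\xrightarrow{\alpha}b_1\xrightarrow{j}b$ with $i,j\in\mathcal I$ and $\alpha\in\mathcal A$; two diagrams are equivalent if they are related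 by isomorphisms $a_1\cong a_2$ and $b_1\cong b_2$ of $\mathcal I$ commuting with all the maps. The composite of $a\xleftarrow{i}w\xrightarrow{\alpha}x\xrightarrow{j}b$ with $b\xleftarrow{k}y\xrightarrow{\gamma}z\xrightarrow{l}c$ is $(lj'')\circ(\gamma'\alpha')\circ(ik'')^*$, where $x\xleftarrow{k'}q\xrightarrow{j'}y$ is the pullback of $j$ and $k$ in $\mathcal I$, $w\xleftarrow{k''}p\xrightarrow{\alpha'}q$ is a pullback of $\alpha$ along $k'$ as in (2), and $\gamma j'=j''\gamma'$ with $\gamma'\in\mathcal A$, $j''\in\mathcal I$. A pair $(\mathcal B,\mathcal A)$ of small categories is a *conjugate pair* if it arises from a factorization $\mathcal U=\mathcal I\circ\mathcal A$ admitting conjugation, with $\mathcal B$ equivalent to $\mathcal I\circ\mathcal A\circ\mathcal I^{\mathrm{op}}$. **The regular bimodule.** A map of $\mathcal I\circ\mathcal A\circ\mathcal I^{\mathrm{op}}$ is *regular* if it lies in the subcategory $\mathcal U$, that is, if it is of the form $j\circ\alpha\circ i^*$ with $i$ an isomorphism of $\mathcal I$; otherwise it is *singular*. Let $\mathcal U(a,b)_+$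 be the set of maps $a\to b$ with all singular maps collapsed to a basepoint, that is, the set of regular maps $a\to b$ with a disjoint basepoint. Pre- and postcomposition make $\mathcal U_+$ a functor $\mathcal A^{\mathrm{op}}\times\mathcal B\to\mathrm{Sets}_*$, the *regular bimodule* (transported along the given equivalence of $\mathcal B$ with $\mathcal I\circ\mathcal A\circ\mathcal I^{\mathrm{op}}$). **The adjunction.** For a based set $S$ and an object $X$ of $\mathcal C$, let $\bigvee_S X$ and $\prod_S X$ denote the coproduct and the product of copies of $X$ indexed by the elements of $S$, the copy at the basepoint being replaced by $0$. A functor $P\colon\mathcal A^{\mathrm{op}}\times\mathcal B\to\mathrm{Sets}_*$ determines an adjoint pair $\mathcal L\colon[\mathcal B^{\mathrm{op}},\mathcal C]\rightleftarrows[\mathcal A^{\mathrm{op}},\mathcal C]\colon\mathcal R$ with $$\mathcal L F(a)=\int^{b\in\mathcal B}\bigvee_{P(a,b)}F(b),\qquad \mathcal R G(b)=\int_{a\in\mathcal A}\prod_{P(a,b)}G(a).$$ **Theorem.** Let $\mathcal C$ be a model category in the above sense and let $(\mathcal B,\mathcal A)$ be a conjugate pair. Then $[\mathcal B^{\mathrm{op}},\mathcal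 C]$ and $[\mathcal A^{\mathrm{op}},\mathcal C]$ carry the projective model structures, and with respect to them the adjoint pair $(\mathcal L,\mathcal R)$ associated to the regular bimodule $P=\mathcal U_+$ is a Quillen pair. -/

import Mathlib

open CategoryTheory CategoryTheory.Limits HomotopicalAlgebra Opposite

universe v u

namespace Conjugation

/-! ### Products and coproducts indexed by based sets -/

section Powers

variable {C : Type u} [Category.{v} C] [HasZeroMorphisms C]

/-- The elements of a based set other than the basepoint. -/
abbrev NonBase (S : Pointed.{v}) : Type v := {s : S // s ≠ S.point}

section Copower

variable [HasColimits C]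

/-- `X ⊗ S`: the coproduct of copies of `X`, one for each non-basepoint element of `S`. -/
noncomputable def copower (X : C) (S : Pointed.{v}) : C := ∐ fun _ : NonBase S => X

open Classical in
/-- The structure map `X ⟶ X ⊗ S` at `s : S`; the one at the basepoint is zero. -/
noncomputable def copower.ι (X : C) (S : Pointed.{v}) (s : S) : X ⟶ copower X S :=
  if h : s = S.point then 0 else Sigma.ι (fun _ : NonBase S => X) ⟨s, h⟩

/-- A based family of maps `X ⟶ Y` induces a map out of `X ⊗ S`. -/
noncomputable def copower.desc {X Y : C} {S : Pointed.{v}} (f : S → (X ⟶ Y)) :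
    copower X S ⟶ Y :=
  Sigma.desc fun s : NonBase S => f s.1

theorem copower.ι_point (X : C) (S : Pointed.{v}) : copower.ι X S S.point = 0 := by
  simp [copower.ι]

theorem copower.ι_desc {X Y : C} {S : Pointed.{v}} (f : S → (X ⟶ Y)) (hf : f S.point = 0)
    (s : S) : copower.ι X S s ≫ copower.desc f = f s := by
  by_cases h : s = S.point
  · subst h
    rw [copower.ι_point, hf, zero_comp]
  · have hs : copower.ι X S s = Sigma.ι (fun _ : NonBase S => X) ⟨s, h⟩ := dif_neg h
    rw [hs]
    exact Sigma.ι_desc (fun s : NonBase S => f s.1) ⟨s, h⟩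

theorem copower.hom_ext {X Y : C} {S : Pointed.{v}} {f g : copower X S ⟶ Y}
    (h : ∀ s, copower.ι X S s ≫ f = copower.ι X S s ≫ g) : f = g := by
  refine Sigma.hom_ext _ _ fun s => ?_
  have := h s.1
  have hs : copower.ι X S s.1 = Sigma.ι (fun _ : NonBase S => X) s := dif_neg s.2
  rw [hs] at this
  exact this

/-- The map `X ⊗ S ⟶ Y ⊗ T` induced by `X ⟶ Y` and a based map `S ⟶ T`. -/
noncomputable def copower.map {X Y : C} (g : X ⟶ Y) {S T : Pointed.{v}} (f : S ⟶ T) :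
    copower X S ⟶ copower Y T :=
  copower.desc fun s => g ≫ copower.ι Y T (f.toFun s)

theorem copower.ι_map {X Y : C} (g : X ⟶ Y) {S T : Pointed.{v}} (f : S ⟶ T) (s : S) :
    copower.ι X S s ≫ copower.map g f = g ≫ copower.ι Y T (f.toFun s) := by
  rw [copower.map, copower.ι_desc]
  rw [f.map_point, copower.ι_point, comp_zero]

theorem copower.map_id (X : C) (S : Pointed.{v}) : copower.map (𝟙 X) (𝟙 S) = 𝟙 _ := by
  refine copower.hom_ext fun s => ?_
  rw [copower.ι_map]
  simp

theorem copower.map_comp {X Y Z : C} (g : X ⟶ Y) (g' : Y ⟶ Z) {S T V : Pointed.{v}}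
    (f : S ⟶ T) (f' : T ⟶ V) :
    copower.map (g ≫ g') (f ≫ f') = copower.map g f ≫ copower.map g' f' := by
  refine copower.hom_ext fun s => ?_
  rw [copower.ι_map, ← Category.assoc, copower.ι_map, Category.assoc, Category.assoc,
    copower.ι_map]
  rfl

end Copower

section Power

variable [HasLimits C]

/-- The product of copies of `X`, one for each non-basepoint element of `S`. -/
noncomputable def power (X : C) (S : Pointed.{v}) : C := ∏ᶜ fun _ : NonBase S => X

open Classical in
/-- The projection at `s : S`; the one at the basepoint is zero. -/
noncomputable def power.π (X : C) (S : Pointed.{v}) (s : S) : power X S ⟶ X :=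
  if h : s = S.point then 0 else Pi.π (fun _ : NonBase S => X) ⟨s, h⟩

/-- A based family of maps `Y ⟶ X` induces a map into the product. -/
noncomputable def power.lift {X Y : C} {S : Pointed.{v}} (f : S → (Y ⟶ X)) :
    Y ⟶ power X S :=
  Pi.lift fun s : NonBase S => f s.1

theorem power.π_point (X : C) (S : Pointed.{v}) : power.π X S S.point = 0 := by
  simp [power.π]

theorem power.lift_π {X Y : C} {S : Pointed.{v}} (f : S → (Y ⟶ X)) (hf : f S.point = 0)
    (s : S) : power.lift f ≫ power.π X S s = f s := by
  by_cases h : s = S.point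
  · subst h
    rw [power.π_point, hf, comp_zero]
  · have hs : power.π X S s = Pi.π (fun _ : NonBase S => X) ⟨s, h⟩ := dif_neg h
    rw [hs]
    exact Pi.lift_π (fun s : NonBase S => f s.1) ⟨s, h⟩

theorem power.hom_ext {X Y : C} {S : Pointed.{v}} {f g : Y ⟶ power X S}
    (h : ∀ s, f ≫ power.π X S s = g ≫ power.π X S s) : f = g := by
  refine Pi.hom_ext _ _ fun s => ?_
  have := h s.1
  have hs : power.π X S s.1 = Pi.π (fun _ : NonBase S => X) s := dif_neg s.2
  rw [hs] at this
  exact this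

/-- The map `∏_T X ⟶ ∏_S Y` induced by `X ⟶ Y` and a based map `S ⟶ T`. -/
noncomputable def power.map {X Y : C} (g : X ⟶ Y) {S T : Pointed.{v}} (f : S ⟶ T) :
    power X T ⟶ power Y S :=
  power.lift fun s => power.π X T (f.toFun s) ≫ g

theorem power.map_π {X Y : C} (g : X ⟶ Y) {S T : Pointed.{v}} (f : S ⟶ T) (s : S) :
    power.map g f ≫ power.π Y S s = power.π X T (f.toFun s) ≫ g := by
  rw [power.map, power.lift_π]
  rw [f.map_point, power.π_point, zero_comp]

theorem power.map_id (X : C) (S : Pointed.{v}) : power.map (𝟙 X) (𝟙 S) = 𝟙 _ := by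
  refine power.hom_ext fun s => ?_
  rw [power.map_π]
  simp

theorem power.map_comp {X Y Z : C} (g : X ⟶ Y) (g' : Y ⟶ Z) {S T V : Pointed.{v}}
    (f : S ⟶ T) (f' : T ⟶ V) :
    power.map (g ≫ g') (f ≫ f') = power.map g f' ≫ power.map g' f := by
  refine power.hom_ext fun s => ?_
  rw [power.map_π, Category.assoc, power.map_π, ← Category.assoc, ← Category.assoc,
    power.map_π]
  rfl

end Power

end Powers

/-! ### The adjoint pair associated to a bimodule -/

section Bimodule

variable {C : Type u} [Category.{v} C] [HasZeroMorphisms C]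
  {𝓐 : Type v} [SmallCategory 𝓐] {𝓑 : Type v} [SmallCategory 𝓑]

section Tensor

variable [HasColimits C]

/-- The functor `𝓑ᵒᵖ × 𝓑 ⥤ C`, `(x, y) ↦ F x ⊗ Q y`. -/
noncomputable def tensorDiagram (F : 𝓑ᵒᵖ ⥤ C) (Q : 𝓑 ⥤ Pointed.{v}) : 𝓑ᵒᵖ ⥤ 𝓑 ⥤ C where
  obj x :=
    { obj := fun y => copower (F.obj x) (Q.obj y)
      map := fun g => copower.map (𝟙 _) (Q.map g)
      map_id := fun y => by rw [Q.map_id, copower.map_id]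
      map_comp := fun g g' => by rw [Q.map_comp, ← copower.map_comp, Category.comp_id] }
  map f :=
    { app := fun y => copower.map (F.map f) (𝟙 _)
      naturality := fun y y' g => by
        rw [← copower.map_comp, ← copower.map_comp]; simp }
  map_id x := by
    ext y
    exact (congrArg (fun k => copower.map k (𝟙 (Q.obj y))) (F.map_id x)).trans
      (copower.map_id _ _)
  map_comp f f' := by
    ext y
    change copower.map _ _ = copower.map _ _ ≫ copower.map _ _
    rw [← copower.map_comp, F.map_comp, Category.comp_id]

/-- The tensor product `F ⊗_𝓑 Q`, the coend of `(x, y) ↦ F x ⊗ Q y`. -/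
noncomputable def tensorOver (F : 𝓑ᵒᵖ ⥤ C) (Q : 𝓑 ⥤ Pointed.{v}) : C :=
  coend (tensorDiagram F Q)

/-- The structure map `F b ⊗ Q b ⟶ F ⊗_𝓑 Q`. -/
noncomputable def tensorOver.incl (F : 𝓑ᵒᵖ ⥤ C) (Q : 𝓑 ⥤ Pointed.{v}) (b : 𝓑) :
    copower (F.obj (op b)) (Q.obj b) ⟶ tensorOver F Q :=
  coend.ι (tensorDiagram F Q) b

theorem tensorOver.incl_condition (F : 𝓑ᵒᵖ ⥤ C) (Q : 𝓑 ⥤ Pointed.{v}) {b b' : 𝓑}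
    (g : b ⟶ b') :
    copower.map (F.map g.op) (𝟙 (Q.obj b)) ≫ tensorOver.incl F Q b =
      copower.map (𝟙 (F.obj (op b'))) (Q.map g) ≫ tensorOver.incl F Q b' :=
  coend.condition (tensorDiagram F Q) g

/-- The structure map `F b ⟶ F ⊗_𝓑 Q` at an element of `Q b`. -/
noncomputable def tensorOver.ι (F : 𝓑ᵒᵖ ⥤ C) (Q : 𝓑 ⥤ Pointed.{v}) (b : 𝓑) (q : Q.obj b) :
    F.obj (op b) ⟶ tensorOver F Q :=
  copower.ι _ _ q ≫ tensorOver.incl F Q b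

theorem tensorOver.hom_ext {F : 𝓑ᵒᵖ ⥤ C} {Q : 𝓑 ⥤ Pointed.{v}} {Y : C}
    {f g : tensorOver F Q ⟶ Y}
    (h : ∀ b q, tensorOver.ι F Q b q ≫ f = tensorOver.ι F Q b q ≫ g) : f = g := by
  refine coend.hom_ext fun b => ?_
  change tensorOver.incl F Q b ≫ f = tensorOver.incl F Q b ≫ g
  refine copower.hom_ext fun q => ?_
  rw [← Category.assoc, ← Category.assoc]
  exact h b q

theorem tensorOver.ι_point (F : 𝓑ᵒᵖ ⥤ C) (Q : 𝓑 ⥤ Pointed.{v}) (b : 𝓑) :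
    tensorOver.ι F Q b (Q.obj b).point = 0 := by
  rw [tensorOver.ι, copower.ι_point, zero_comp]

theorem tensorOver.ι_condition (F : 𝓑ᵒᵖ ⥤ C) (Q : 𝓑 ⥤ Pointed.{v}) {b b' : 𝓑}
    (g : b ⟶ b') (q : Q.obj b) :
    F.map g.op ≫ tensorOver.ι F Q b q = tensorOver.ι F Q b' ((Q.map g).toFun q) := by
  have h := copower.ι _ _ q ≫= tensorOver.incl_condition F Q g
  rw [← Category.assoc, ← Category.assoc, copower.ι_map, copower.ι_map, Category.id_comp,
    Category.assoc] at h
  exact h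

/-- A compatible based family of maps `F b ⟶ Y` induces a map out of `F ⊗_𝓑 Q`. -/
noncomputable def tensorOver.desc {F : 𝓑ᵒᵖ ⥤ C} {Q : 𝓑 ⥤ Pointed.{v}} {Y : C}
    (f : ∀ b, Q.obj b → (F.obj (op b) ⟶ Y)) (h0 : ∀ b, f b (Q.obj b).point = 0)
    (hf : ∀ ⦃b b' : 𝓑⦄ (g : b ⟶ b') (q : Q.obj b),
      F.map g.op ≫ f b q = f b' ((Q.map g).toFun q)) : tensorOver F Q ⟶ Y :=
  coend.desc (F := tensorDiagram F Q) (fun b => copower.desc (f b))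
    (fun b b' g => copower.hom_ext fun q => by
      change copower.ι _ _ q ≫ copower.map (F.map g.op) (𝟙 (Q.obj b)) ≫ copower.desc (f b) =
        copower.ι _ _ q ≫ copower.map (𝟙 (F.obj (op b'))) (Q.map g) ≫ copower.desc (f b')
      rw [← Category.assoc, ← Category.assoc, copower.ι_map, copower.ι_map, Category.assoc,
        Category.assoc, copower.ι_desc _ (h0 b), copower.ι_desc _ (h0 b'), Category.id_comp]
      exact hf g q)

theorem tensorOver.ι_desc {F : 𝓑ᵒᵖ ⥤ C} {Q : 𝓑 ⥤ Pointed.{v}} {Y : C}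
    (f : ∀ b, Q.obj b → (F.obj (op b) ⟶ Y)) (h0 : ∀ b, f b (Q.obj b).point = 0)
    (hf : ∀ ⦃b b' : 𝓑⦄ (g : b ⟶ b') (q : Q.obj b),
      F.map g.op ≫ f b q = f b' ((Q.map g).toFun q)) (b : 𝓑) (q : Q.obj b) :
    tensorOver.ι F Q b q ≫ tensorOver.desc f h0 hf = f b q := by
  have h : tensorOver.incl F Q b ≫ tensorOver.desc f h0 hf = copower.desc (f b) :=
    coend.ι_desc (F := tensorDiagram F Q) _ _ b
  rw [tensorOver.ι, Category.assoc, h]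
  exact copower.ι_desc _ (h0 b) q

/-- Functoriality of `F ⊗_𝓑 Q` in both variables. -/
noncomputable def tensorOver.map {F F' : 𝓑ᵒᵖ ⥤ C} (φ : F ⟶ F') {Q Q' : 𝓑 ⥤ Pointed.{v}}
    (ψ : Q ⟶ Q') : tensorOver F Q ⟶ tensorOver F' Q' :=
  tensorOver.desc (fun b q => φ.app (op b) ≫ tensorOver.ι F' Q' b ((ψ.app b).toFun q))
    (fun b => by rw [(ψ.app b).map_point, tensorOver.ι_point, comp_zero])
    (fun b b' g q => by
      rw [← Category.assoc, φ.naturality, Category.assoc, tensorOver.ι_condition]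
      have := congrArg (fun k => Pointed.Hom.toFun k q) (ψ.naturality g)
      exact congrArg (fun r => φ.app (op b') ≫ tensorOver.ι F' Q' b' r) this.symm)

theorem tensorOver.ι_map {F F' : 𝓑ᵒᵖ ⥤ C} (φ : F ⟶ F') {Q Q' : 𝓑 ⥤ Pointed.{v}}
    (ψ : Q ⟶ Q') (b : 𝓑) (q : Q.obj b) :
    tensorOver.ι F Q b q ≫ tensorOver.map φ ψ =
      φ.app (op b) ≫ tensorOver.ι F' Q' b ((ψ.app b).toFun q) :=
  tensorOver.ι_desc _ _ _ b q

theorem tensorOver.map_id (F : 𝓑ᵒᵖ ⥤ C) (Q : 𝓑 ⥤ Pointed.{v}) :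
    tensorOver.map (𝟙 F) (𝟙 Q) = 𝟙 _ := by
  refine tensorOver.hom_ext fun b q => ?_
  rw [tensorOver.ι_map]
  simp

theorem tensorOver.map_comp {F F' F'' : 𝓑ᵒᵖ ⥤ C} (φ : F ⟶ F') (φ' : F' ⟶ F'')
    {Q Q' Q'' : 𝓑 ⥤ Pointed.{v}} (ψ : Q ⟶ Q') (ψ' : Q' ⟶ Q'') :
    tensorOver.map (φ ≫ φ') (ψ ≫ ψ') = tensorOver.map φ ψ ≫ tensorOver.map φ' ψ' := by
  refine tensorOver.hom_ext fun b q => ?_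
  rw [tensorOver.ι_map, ← Category.assoc, tensorOver.ι_map, Category.assoc,
    tensorOver.ι_map, ← Category.assoc]
  rfl

/-- The functor `𝓛 : [𝓑ᵒᵖ, C] ⥤ [𝓐ᵒᵖ, C]`, `𝓛 F a = F ⊗_𝓑 P(a, -)`. -/
noncomputable def leftFunctor (P : 𝓐ᵒᵖ ⥤ 𝓑 ⥤ Pointed.{v}) : (𝓑ᵒᵖ ⥤ C) ⥤ (𝓐ᵒᵖ ⥤ C) where
  obj F :=
    { obj := fun a => tensorOver F (P.obj a)
      map := fun g => tensorOver.map (𝟙 F) (P.map g)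
      map_id := fun a => by rw [P.map_id, tensorOver.map_id]
      map_comp := fun g g' => by rw [P.map_comp, ← tensorOver.map_comp, Category.comp_id] }
  map φ :=
    { app := fun a => tensorOver.map φ (𝟙 _)
      naturality := fun a a' g => by
        rw [← tensorOver.map_comp, ← tensorOver.map_comp]; simp }
  map_id F := by
    ext a
    exact tensorOver.map_id _ _
  map_comp φ φ' := by
    ext a
    change tensorOver.map _ _ = tensorOver.map _ _ ≫ tensorOver.map _ _
    rw [← tensorOver.map_comp, Category.comp_id]

end Tensor

section Hom

variable [HasLimits C]

/-- The functor `𝓐ᵒᵖ × 𝓐 ⥤ C`, `(x, y) ↦ ∏_{Q y} G x`. -/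
noncomputable def homDiagram (Q : 𝓐ᵒᵖ ⥤ Pointed.{v}) (G : 𝓐ᵒᵖ ⥤ C) : 𝓐ᵒᵖ ⥤ 𝓐 ⥤ C where
  obj x :=
    { obj := fun y => power (G.obj x) (Q.obj (op y))
      map := fun g => power.map (𝟙 _) (Q.map g.op)
      map_id := fun y => by rw [op_id, Q.map_id, power.map_id]
      map_comp := fun g g' => by
        rw [op_comp, Q.map_comp, ← power.map_comp, Category.comp_id] }
  map f :=
    { app := fun y => power.map (G.map f) (𝟙 _)
      naturality := fun y y' g => by
        rw [← power.map_comp, ← power.map_comp]; simp }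
  map_id x := by
    ext y
    exact (congrArg (fun k => power.map k (𝟙 (Q.obj (op y)))) (G.map_id x)).trans
      (power.map_id _ _)
  map_comp f f' := by
    ext y
    change power.map _ _ = power.map _ _ ≫ power.map _ _
    rw [← power.map_comp, G.map_comp, Category.comp_id]

/-- `Hom^𝓐(Q, G)`, the end of `(x, y) ↦ ∏_{Q y} G x`. -/
noncomputable def homOver (Q : 𝓐ᵒᵖ ⥤ Pointed.{v}) (G : 𝓐ᵒᵖ ⥤ C) : C :=
  end_ (homDiagram Q G)

/-- The projection `Hom^𝓐(Q, G) ⟶ ∏_{Q a} G a`. -/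
noncomputable def homOver.proj (Q : 𝓐ᵒᵖ ⥤ Pointed.{v}) (G : 𝓐ᵒᵖ ⥤ C) (a : 𝓐) :
    homOver Q G ⟶ power (G.obj (op a)) (Q.obj (op a)) :=
  end_.π (homDiagram Q G) a

theorem homOver.proj_condition (Q : 𝓐ᵒᵖ ⥤ Pointed.{v}) (G : 𝓐ᵒᵖ ⥤ C) {a a' : 𝓐}
    (g : a ⟶ a') :
    homOver.proj Q G a ≫ power.map (𝟙 (G.obj (op a))) (Q.map g.op) =
      homOver.proj Q G a' ≫ power.map (G.map g.op) (𝟙 (Q.obj (op a'))) :=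
  end_.condition (homDiagram Q G) g

/-- The projection `Hom^𝓐(Q, G) ⟶ G a` at an element of `Q a`. -/
noncomputable def homOver.π (Q : 𝓐ᵒᵖ ⥤ Pointed.{v}) (G : 𝓐ᵒᵖ ⥤ C) (a : 𝓐)
    (q : Q.obj (op a)) : homOver Q G ⟶ G.obj (op a) :=
  homOver.proj Q G a ≫ power.π _ _ q

theorem homOver.hom_ext {Q : 𝓐ᵒᵖ ⥤ Pointed.{v}} {G : 𝓐ᵒᵖ ⥤ C} {Y : C}
    {f g : Y ⟶ homOver Q G}
    (h : ∀ a q, f ≫ homOver.π Q G a q = g ≫ homOver.π Q G a q) : f = g := by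
  refine end_.hom_ext fun a => ?_
  change f ≫ homOver.proj Q G a = g ≫ homOver.proj Q G a
  refine power.hom_ext fun q => ?_
  rw [Category.assoc, Category.assoc]
  exact h a q

theorem homOver.π_point (Q : 𝓐ᵒᵖ ⥤ Pointed.{v}) (G : 𝓐ᵒᵖ ⥤ C) (a : 𝓐) :
    homOver.π Q G a (Q.obj (op a)).point = 0 := by
  rw [homOver.π, power.π_point, comp_zero]

theorem homOver.π_condition (Q : 𝓐ᵒᵖ ⥤ Pointed.{v}) (G : 𝓐ᵒᵖ ⥤ C) {a a' : 𝓐}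
    (g : a ⟶ a') (q : Q.obj (op a')) :
    homOver.π Q G a' q ≫ G.map g.op = homOver.π Q G a ((Q.map g.op).toFun q) := by
  have h := homOver.proj_condition Q G g =≫ power.π _ _ q
  rw [Category.assoc, Category.assoc, power.map_π, power.map_π, Category.comp_id] at h
  rw [homOver.π, Category.assoc]
  exact h.symm

/-- A compatible based family of maps `Y ⟶ G a` induces a map into `Hom^𝓐(Q, G)`. -/
noncomputable def homOver.lift {Q : 𝓐ᵒᵖ ⥤ Pointed.{v}} {G : 𝓐ᵒᵖ ⥤ C} {Y : C}
    (f : ∀ a, Q.obj (op a) → (Y ⟶ G.obj (op a)))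
    (h0 : ∀ a, f a (Q.obj (op a)).point = 0)
    (hf : ∀ ⦃a a' : 𝓐⦄ (g : a ⟶ a') (q : Q.obj (op a')),
      f a' q ≫ G.map g.op = f a ((Q.map g.op).toFun q)) : Y ⟶ homOver Q G :=
  end_.lift (F := homDiagram Q G) (fun a => power.lift (f a))
    (fun a a' g => power.hom_ext fun q => by
      change (power.lift (f a) ≫ power.map (𝟙 (G.obj (op a))) (Q.map g.op)) ≫
        power.π _ _ q = (power.lift (f a') ≫ power.map (G.map g.op) (𝟙 (Q.obj (op a')))) ≫
        power.π _ _ q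
      rw [Category.assoc, Category.assoc, power.map_π, power.map_π, ← Category.assoc,
        ← Category.assoc, power.lift_π _ (h0 a), power.lift_π _ (h0 a'), Category.comp_id]
      exact (hf g q).symm)

theorem homOver.lift_π {Q : 𝓐ᵒᵖ ⥤ Pointed.{v}} {G : 𝓐ᵒᵖ ⥤ C} {Y : C}
    (f : ∀ a, Q.obj (op a) → (Y ⟶ G.obj (op a)))
    (h0 : ∀ a, f a (Q.obj (op a)).point = 0)
    (hf : ∀ ⦃a a' : 𝓐⦄ (g : a ⟶ a') (q : Q.obj (op a')),
      f a' q ≫ G.map g.op = f a ((Q.map g.op).toFun q)) (a : 𝓐) (q : Q.obj (op a)) :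
    homOver.lift f h0 hf ≫ homOver.π Q G a q = f a q := by
  have h : homOver.lift f h0 hf ≫ homOver.proj Q G a = power.lift (f a) :=
    end_.lift_π (F := homDiagram Q G) _ _ a
  rw [homOver.π, ← Category.assoc, h]
  exact power.lift_π _ (h0 a) q

/-- Functoriality of `Hom^𝓐(Q, G)`, contravariant in `Q` and covariant in `G`. -/
noncomputable def homOver.map {Q Q' : 𝓐ᵒᵖ ⥤ Pointed.{v}} (ψ : Q' ⟶ Q) {G G' : 𝓐ᵒᵖ ⥤ C}
    (φ : G ⟶ G') : homOver Q G ⟶ homOver Q' G' :=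
  homOver.lift (fun a q => homOver.π Q G a ((ψ.app (op a)).toFun q) ≫ φ.app (op a))
    (fun a => by rw [(ψ.app (op a)).map_point, homOver.π_point, zero_comp])
    (fun a a' g q => by
      rw [Category.assoc, ← φ.naturality, ← Category.assoc, homOver.π_condition]
      have := congrArg (fun k => Pointed.Hom.toFun k q) (ψ.naturality g.op)
      exact congrArg (fun r => homOver.π Q G a r ≫ φ.app (op a)) this.symm)

theorem homOver.map_π {Q Q' : 𝓐ᵒᵖ ⥤ Pointed.{v}} (ψ : Q' ⟶ Q) {G G' : 𝓐ᵒᵖ ⥤ C}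
    (φ : G ⟶ G') (a : 𝓐) (q : Q'.obj (op a)) :
    homOver.map ψ φ ≫ homOver.π Q' G' a q =
      homOver.π Q G a ((ψ.app (op a)).toFun q) ≫ φ.app (op a) :=
  homOver.lift_π _ _ _ a q

theorem homOver.map_id (Q : 𝓐ᵒᵖ ⥤ Pointed.{v}) (G : 𝓐ᵒᵖ ⥤ C) :
    homOver.map (𝟙 Q) (𝟙 G) = 𝟙 _ := by
  refine homOver.hom_ext fun b q => ?_
  rw [homOver.map_π]
  simp

theorem homOver.map_comp {Q Q' Q'' : 𝓐ᵒᵖ ⥤ Pointed.{v}} (ψ : Q' ⟶ Q) (ψ' : Q'' ⟶ Q')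
    {G G' G'' : 𝓐ᵒᵖ ⥤ C} (φ : G ⟶ G') (φ' : G' ⟶ G'') :
    homOver.map (ψ' ≫ ψ) (φ ≫ φ') = homOver.map ψ φ ≫ homOver.map ψ' φ' := by
  refine homOver.hom_ext fun b q => ?_
  rw [homOver.map_π, Category.assoc, homOver.map_π, ← Category.assoc, homOver.map_π,
    Category.assoc]
  rfl

/-- The functor `𝓡 : [𝓐ᵒᵖ, C] ⥤ [𝓑ᵒᵖ, C]`, `𝓡 G b = Hom^𝓐(P(-, b), G)`. -/
noncomputable def rightFunctor (P : 𝓐ᵒᵖ ⥤ 𝓑 ⥤ Pointed.{v}) : (𝓐ᵒᵖ ⥤ C) ⥤ (𝓑ᵒᵖ ⥤ C) where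
  obj G :=
    { obj := fun b => homOver (P.flip.obj b.unop) G
      map := fun g => homOver.map (P.flip.map g.unop) (𝟙 G)
      map_id := fun b => by rw [unop_id, P.flip.map_id, homOver.map_id]
      map_comp := fun g g' => by
        rw [unop_comp, P.flip.map_comp, ← homOver.map_comp, Category.comp_id] }
  map φ :=
    { app := fun b => homOver.map (𝟙 _) φ
      naturality := fun b b' g => by
        rw [← homOver.map_comp, ← homOver.map_comp]; simp }
  map_id F := by
    ext a
    exact homOver.map_id _ _
  map_comp φ φ' := by
    ext a
    change homOver.map _ _ = homOver.map _ _ ≫ homOver.map _ _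
    rw [← homOver.map_comp, Category.comp_id]

end Hom

section Adjunction

/-- A compatible family of maps `F b ⟶ G a` indexed by the elements of `P(a, b)`. Maps
`𝓛 F ⟶ G` and maps `F ⟶ 𝓡 G` both amount to such families. -/
@[ext]
structure BimoduleFamily (P : 𝓐ᵒᵖ ⥤ 𝓑 ⥤ Pointed.{v}) (F : 𝓑ᵒᵖ ⥤ C) (G : 𝓐ᵒᵖ ⥤ C) where
  /-- the maps of the family -/
  hom (a : 𝓐) (b : 𝓑) (p : (P.obj (op a)).obj b) : F.obj (op b) ⟶ G.obj (op a)
  hom_point (a : 𝓐) (b : 𝓑) : hom a b ((P.obj (op a)).obj b).point = 0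
  natural_left (a : 𝓐) {b b' : 𝓑} (g : b ⟶ b') (p : (P.obj (op a)).obj b) :
    F.map g.op ≫ hom a b p = hom a b' (((P.obj (op a)).map g).toFun p)
  natural_right {a a' : 𝓐} (g : a ⟶ a') (b : 𝓑) (p : (P.obj (op a')).obj b) :
    hom a' b p ≫ G.map g.op = hom a b (((P.map g.op).app b).toFun p)

/-- The family associated to a map `𝓛 F ⟶ G`. -/
noncomputable def familyOfLeft [HasColimits C] {P : 𝓐ᵒᵖ ⥤ 𝓑 ⥤ Pointed.{v}} {F : 𝓑ᵒᵖ ⥤ C}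
    {G : 𝓐ᵒᵖ ⥤ C} (φ : (leftFunctor P).obj F ⟶ G) : BimoduleFamily P F G :=
  let ψ (a : 𝓐) : tensorOver F (P.obj (op a)) ⟶ G.obj (op a) := φ.app (op a)
  { hom := fun a b p => tensorOver.ι F (P.obj (op a)) b p ≫ ψ a
    hom_point := fun a b => by rw [tensorOver.ι_point, zero_comp]
    natural_left := fun a b b' g p => by
      rw [← Category.assoc, tensorOver.ι_condition]
    natural_right := fun {a a'} g b p => by
      have h : tensorOver.map (𝟙 F) (P.map g.op) ≫ ψ a = ψ a' ≫ G.map g.op :=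
        φ.naturality g.op
      rw [Category.assoc, ← h, ← Category.assoc, tensorOver.ι_map, NatTrans.id_app,
        Category.id_comp] }

/-- The components of the map `𝓛 F ⟶ G` associated to a family. -/
noncomputable def leftComponent [HasColimits C] {P : 𝓐ᵒᵖ ⥤ 𝓑 ⥤ Pointed.{v}} {F : 𝓑ᵒᵖ ⥤ C}
    {G : 𝓐ᵒᵖ ⥤ C} (f : BimoduleFamily P F G) (a : 𝓐ᵒᵖ) : tensorOver F (P.obj a) ⟶ G.obj a :=
  tensorOver.desc (fun b p => f.hom a.unop b p) (fun b => f.hom_point a.unop b)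
    (fun _ _ g p => f.natural_left a.unop g p)

theorem ι_leftComponent [HasColimits C] {P : 𝓐ᵒᵖ ⥤ 𝓑 ⥤ Pointed.{v}} {F : 𝓑ᵒᵖ ⥤ C}
    {G : 𝓐ᵒᵖ ⥤ C} (f : BimoduleFamily P F G) (a : 𝓐ᵒᵖ) (b : 𝓑) (p : (P.obj a).obj b) :
    tensorOver.ι F (P.obj a) b p ≫ leftComponent f a = f.hom a.unop b p :=
  tensorOver.ι_desc _ _ _ b p

/-- Maps `𝓛 F ⟶ G` as compatible families. -/
noncomputable def leftHomEquiv [HasColimits C] (P : 𝓐ᵒᵖ ⥤ 𝓑 ⥤ Pointed.{v}) (F : 𝓑ᵒᵖ ⥤ C)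
    (G : 𝓐ᵒᵖ ⥤ C) : ((leftFunctor P).obj F ⟶ G) ≃ BimoduleFamily P F G where
  toFun φ := familyOfLeft φ
  invFun f :=
    { app := leftComponent f
      naturality := fun a a' g => tensorOver.hom_ext fun b p => by
        change tensorOver.ι F (P.obj a) b p ≫ tensorOver.map (𝟙 F) (P.map g) ≫
          leftComponent f a' = tensorOver.ι F (P.obj a) b p ≫ leftComponent f a ≫ G.map g
        rw [← Category.assoc, tensorOver.ι_map, Category.assoc, ι_leftComponent,
          ← Category.assoc, ι_leftComponent, NatTrans.id_app, Category.id_comp]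
        exact (f.natural_right g.unop b p).symm }
  left_inv φ := by
    ext a
    exact tensorOver.hom_ext fun b p => ι_leftComponent (familyOfLeft φ) a b p
  right_inv f := by
    ext a b p
    exact ι_leftComponent f (op a) b p

/-- The family associated to a map `F ⟶ 𝓡 G`. -/
noncomputable def familyOfRight [HasLimits C] {P : 𝓐ᵒᵖ ⥤ 𝓑 ⥤ Pointed.{v}} {F : 𝓑ᵒᵖ ⥤ C}
    {G : 𝓐ᵒᵖ ⥤ C} (φ : F ⟶ (rightFunctor P).obj G) : BimoduleFamily P F G :=
  let ψ (b : 𝓑) : F.obj (op b) ⟶ homOver (P.flip.obj b) G := φ.app (op b)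
  { hom := fun a b p => ψ b ≫ homOver.π (P.flip.obj b) G a p
    hom_point := fun a b => by
      have h : homOver.π (P.flip.obj b) G a ((P.obj (op a)).obj b).point = 0 :=
        homOver.π_point (P.flip.obj b) G a
      rw [h, comp_zero]
    natural_left := fun a b b' g p => by
      have h : F.map g.op ≫ ψ b = ψ b' ≫ homOver.map (P.flip.map g) (𝟙 G) :=
        φ.naturality g.op
      rw [← Category.assoc, h, Category.assoc, homOver.map_π, NatTrans.id_app,
        Category.comp_id]
      rfl
    natural_right := fun {a a'} g b p => by
      have h := homOver.π_condition (P.flip.obj b) G g p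
      rw [Category.assoc, h]
      rfl }

/-- The components of the map `F ⟶ 𝓡 G` associated to a family. -/
noncomputable def rightComponent [HasLimits C] {P : 𝓐ᵒᵖ ⥤ 𝓑 ⥤ Pointed.{v}} {F : 𝓑ᵒᵖ ⥤ C}
    {G : 𝓐ᵒᵖ ⥤ C} (f : BimoduleFamily P F G) (b : 𝓑ᵒᵖ) :
    F.obj b ⟶ homOver (P.flip.obj b.unop) G :=
  homOver.lift (fun a p => f.hom a b.unop p) (fun a => f.hom_point a b.unop)
    (fun _ _ g p => f.natural_right g b.unop p)

theorem rightComponent_π [HasLimits C] {P : 𝓐ᵒᵖ ⥤ 𝓑 ⥤ Pointed.{v}} {F : 𝓑ᵒᵖ ⥤ C}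
    {G : 𝓐ᵒᵖ ⥤ C} (f : BimoduleFamily P F G) (b : 𝓑ᵒᵖ) (a : 𝓐)
    (p : (P.flip.obj b.unop).obj (op a)) :
    rightComponent f b ≫ homOver.π (P.flip.obj b.unop) G a p = f.hom a b.unop p :=
  homOver.lift_π _ _ _ a p

/-- Maps `F ⟶ 𝓡 G` as compatible families. -/
noncomputable def rightHomEquiv [HasLimits C] (P : 𝓐ᵒᵖ ⥤ 𝓑 ⥤ Pointed.{v}) (F : 𝓑ᵒᵖ ⥤ C)
    (G : 𝓐ᵒᵖ ⥤ C) : (F ⟶ (rightFunctor P).obj G) ≃ BimoduleFamily P F G where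
  toFun φ := familyOfRight φ
  invFun f :=
    { app := rightComponent f
      naturality := fun b b' g => homOver.hom_ext fun a p => by
        change (F.map g ≫ rightComponent f b') ≫ homOver.π (P.flip.obj b'.unop) G a p =
          (rightComponent f b ≫ homOver.map (P.flip.map g.unop) (𝟙 G)) ≫
            homOver.π (P.flip.obj b'.unop) G a p
        rw [Category.assoc, rightComponent_π, Category.assoc, homOver.map_π,
          ← Category.assoc, rightComponent_π, NatTrans.id_app, Category.comp_id]
        exact f.natural_left a g.unop p }
  left_inv φ := by
    ext b
    exact homOver.hom_ext fun a p => rightComponent_π (familyOfRight φ) b a p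
  right_inv f := by
    ext a b p
    exact rightComponent_π f (op b) a p

theorem leftHomEquiv_comp [HasColimits C] (P : 𝓐ᵒᵖ ⥤ 𝓑 ⥤ Pointed.{v}) {F : 𝓑ᵒᵖ ⥤ C}
    {G G' : 𝓐ᵒᵖ ⥤ C} (φ : (leftFunctor P).obj F ⟶ G) (γ : G ⟶ G') (a : 𝓐) (b : 𝓑)
    (p : (P.obj (op a)).obj b) :
    (leftHomEquiv P F G' (φ ≫ γ)).hom a b p = (leftHomEquiv P F G φ).hom a b p ≫ γ.app _ :=
  (Category.assoc (tensorOver.ι F (P.obj (op a)) b p) _ _).symm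

theorem leftHomEquiv_map_comp [HasColimits C] (P : 𝓐ᵒᵖ ⥤ 𝓑 ⥤ Pointed.{v}) {F F' : 𝓑ᵒᵖ ⥤ C}
    {G : 𝓐ᵒᵖ ⥤ C} (γ : F ⟶ F') (φ : (leftFunctor P).obj F' ⟶ G) (a : 𝓐) (b : 𝓑)
    (p : (P.obj (op a)).obj b) :
    (leftHomEquiv P F G ((leftFunctor P).map γ ≫ φ)).hom a b p =
      γ.app _ ≫ (leftHomEquiv P F' G φ).hom a b p := by
  let ψ : tensorOver F' (P.obj (op a)) ⟶ G.obj (op a) := φ.app (op a)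
  change tensorOver.ι F (P.obj (op a)) b p ≫ tensorOver.map γ (𝟙 (P.obj (op a))) ≫ ψ =
    γ.app _ ≫ tensorOver.ι F' (P.obj (op a)) b p ≫ ψ
  rw [← Category.assoc, tensorOver.ι_map, Category.assoc]
  rfl

theorem rightHomEquiv_comp [HasLimits C] (P : 𝓐ᵒᵖ ⥤ 𝓑 ⥤ Pointed.{v}) {F F' : 𝓑ᵒᵖ ⥤ C}
    {G : 𝓐ᵒᵖ ⥤ C} (γ : F ⟶ F') (φ : F' ⟶ (rightFunctor P).obj G) (a : 𝓐) (b : 𝓑)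
    (p : (P.obj (op a)).obj b) :
    (rightHomEquiv P F G (γ ≫ φ)).hom a b p =
      γ.app _ ≫ (rightHomEquiv P F' G φ).hom a b p :=
  Category.assoc (γ.app (op b)) _ (homOver.π (P.flip.obj b) G a p)

theorem rightHomEquiv_comp_map [HasLimits C] (P : 𝓐ᵒᵖ ⥤ 𝓑 ⥤ Pointed.{v}) {F : 𝓑ᵒᵖ ⥤ C}
    {G G' : 𝓐ᵒᵖ ⥤ C} (φ : F ⟶ (rightFunctor P).obj G) (γ : G ⟶ G') (a : 𝓐) (b : 𝓑)
    (p : (P.obj (op a)).obj b) :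
    (rightHomEquiv P F G' (φ ≫ (rightFunctor P).map γ)).hom a b p =
      (rightHomEquiv P F G φ).hom a b p ≫ γ.app _ := by
  let ψ : F.obj (op b) ⟶ homOver (P.flip.obj b) G := φ.app (op b)
  change (ψ ≫ homOver.map (𝟙 (P.flip.obj b)) γ) ≫ homOver.π (P.flip.obj b) G' a p =
    (ψ ≫ homOver.π (P.flip.obj b) G a p) ≫ γ.app _
  rw [Category.assoc, homOver.map_π, Category.assoc]
  rfl

/-- The adjunction `𝓛 ⊣ 𝓡` associated to a bimodule. -/
noncomputable def bimoduleAdjunction [HasLimits C] [HasColimits C]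
    (P : 𝓐ᵒᵖ ⥤ 𝓑 ⥤ Pointed.{v}) : leftFunctor (C := C) P ⊣ rightFunctor P :=
  Adjunction.mkOfHomEquiv
    { homEquiv := fun F G => (leftHomEquiv P F G).trans (rightHomEquiv P F G).symm
      homEquiv_naturality_left_symm := fun {F F' G} f g => by
        apply (leftHomEquiv P F G).injective
        ext a b p
        rw [leftHomEquiv_map_comp]
        simp [rightHomEquiv_comp]
      homEquiv_naturality_right := fun {F G G'} f g => by
        apply (rightHomEquiv P F G').injective
        ext a b p
        rw [rightHomEquiv_comp_map]
        simp [leftHomEquiv_comp] }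

end Adjunction

end Bimodule

/-! ### Indexing categories and factorizations admitting conjugation -/

/-- An indexing category: a small EI-category with pullbacks, each of whose comma categories
`J ↓ a` has a skeleton with finitely many objects. -/
structure IsIndexingCategory (J : Type v) [SmallCategory J] : Prop where
  isIso_endo {x : J} (f : x ⟶ x) : IsIso f
  hasPullbacks : HasPullbacks J
  finite_skeleton (a : J) : Finite (Skeleton (Over a))

section Conj

variable {U : Type v} [SmallCategory U]

/-- An isomorphism which is an isomorphism of the wide subcategory `W`. -/
def IsoIn (W : MorphismProperty U) {x y : U} (e : x ≅ y) : Prop := W e.hom ∧ W e.inv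

/-- `U = I ∘ A` is a factorization admitting conjugation. The wide subcategories `I` and `A` are
given by their classes of morphisms. -/
structure AdmitsConjugation (I A : MorphismProperty U) [I.IsMultiplicative]
    [A.IsMultiplicative] : Prop where
  indexing : IsIndexingCategory (WideSubcategory I)
  factors {a b : U} (f : a ⟶ b) :
    ∃ (c : U) (α : a ⟶ c) (i : c ⟶ b), A α ∧ I i ∧ α ≫ i = f
  iso_subset {x y : U} (e : x ≅ y) : IsoIn I e → IsoIn A e
  /-- the factorization is unique up to lifting isomorphisms in `I` -/
  lift {a b c d : U} (α : a ⟶ b) (i : b ⟶ d) (β : a ⟶ c) (j : c ⟶ d) :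
    A α → I i → A β → I j → α ≫ i = β ≫ j →
      ∃ e : c ≅ b, IsoIn I e ∧ β ≫ e.hom = α ∧ e.hom ≫ i = j
  /-- maps in `A` can be pulled back along maps in `I` -/
  exists_pullback {a b c : U} (α : a ⟶ b) (i : c ⟶ b) : A α → I i →
    ∃ (p : U) (i' : p ⟶ a) (α' : p ⟶ c), I i' ∧ A α' ∧ IsPullback i' α' α i
  /-- such pullbacks are unique up to isomorphisms in `I` -/
  pullback_iso {a b c p q : U} {α : a ⟶ b} {i : c ⟶ b} {i' : p ⟶ a} {α' : p ⟶ c}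
    {i'' : q ⟶ a} {α'' : q ⟶ c} : A α → I i → I i' → A α' → I i'' → A α'' →
      ∀ (h : IsPullback i' α' α i) (h' : IsPullback i'' α'' α i),
        IsoIn I (h.isoIsPullback _ _ h')

/-- A diagram `a ⟵ a₁ ⟶ b₁ ⟶ b` with outer maps `i`, `j` in `I` and middle map `α` in `A`. -/
structure ThreeFold (I A : MorphismProperty U) (a b : U) where
  /-- the source of the middle map -/
  a₁ : U
  /-- the target of the middle map -/
  b₁ : U
  /-- the map whose formal opposite is the cokernel -/
  i : a₁ ⟶ a
  /-- the middle map -/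
  α : a₁ ⟶ b₁
  /-- the image -/
  j : b₁ ⟶ b
  hi : I i
  hα : A α
  hj : I j

namespace ThreeFold

variable {I A : MorphismProperty U}

/-- Two diagrams are equivalent if they are related by isomorphisms `φ`, `ψ` in `I`. -/
def Rel {a b : U} (t s : ThreeFold I A a b) : Prop :=
  ∃ (φ : t.a₁ ≅ s.a₁) (ψ : t.b₁ ≅ s.b₁), IsoIn I φ ∧ IsoIn I ψ ∧
    φ.hom ≫ s.i = t.i ∧ φ.hom ≫ s.α = t.α ≫ ψ.hom ∧ ψ.hom ≫ s.j = t.j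

instance setoid (I A : MorphismProperty U) [I.IsMultiplicative] (a b : U) :
    Setoid (ThreeFold I A a b) where
  r := Rel
  iseqv :=
    { refl := fun t => ⟨Iso.refl _, Iso.refl _, ⟨I.id_mem _, I.id_mem _⟩,
        ⟨I.id_mem _, I.id_mem _⟩, by simp, by simp, by simp⟩
      symm := by
        rintro t s ⟨φ, ψ, hφ, hψ, h1, h2, h3⟩
        refine ⟨φ.symm, ψ.symm, ⟨hφ.2, hφ.1⟩, ⟨hψ.2, hψ.1⟩, ?_, ?_, ?_⟩
        · simp [← h1]
        · rw [Iso.symm_hom, Iso.symm_hom, Iso.inv_comp_eq, ← Category.assoc, h2]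
          simp
        · simp [← h3]
      trans := by
        rintro t s r ⟨φ, ψ, hφ, hψ, h1, h2, h3⟩ ⟨φ', ψ', hφ', hψ', h1', h2', h3'⟩
        refine ⟨φ ≪≫ φ', ψ ≪≫ ψ', ⟨I.comp_mem _ _ hφ.1 hφ'.1, I.comp_mem _ _ hφ'.2 hφ.2⟩,
          ⟨I.comp_mem _ _ hψ.1 hψ'.1, I.comp_mem _ _ hψ'.2 hψ.2⟩, ?_, ?_, ?_⟩
        · simp [h1, h1']
        · simp only [Iso.trans_hom, Category.assoc]
          rw [h2', ← Category.assoc, h2, Category.assoc]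
        · simp [h3, h3'] }

/-- The identity diagram. -/
def id (I A : MorphismProperty U) [I.IsMultiplicative] [A.IsMultiplicative] (a : U) :
    ThreeFold I A a a :=
  ⟨a, a, 𝟙 a, 𝟙 a, 𝟙 a, I.id_mem _, A.id_mem _, I.id_mem _⟩

/-- The last two legs of a diagram, composed in `U`. -/
def reg {a b : U} (t : ThreeFold I A a b) : t.a₁ ⟶ b := t.α ≫ t.j

variable [I.IsMultiplicative] [A.IsMultiplicative]

/-- A diagram computing the composite of `t` and `s`: the middle diamond is a pullback in `I`,
the left square is a pullback of a map in `A` along a map in `I`, and the right square is a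
factorization as a map in `A` followed by a map in `I`. -/
structure CompDiagram {a b c : U} (t : ThreeFold I A a b) (s : ThreeFold I A b c) where
  /-- the top of the middle diamond -/
  q : U
  /-- the left leg of the middle diamond -/
  k' : q ⟶ t.b₁
  /-- the right leg of the middle diamond -/
  j' : q ⟶ s.a₁
  hk' : I k'
  hj' : I j'
  middle : IsPullback (C := WideSubcategory I)
    (⟨k', hk'⟩ : (⟨q⟩ : WideSubcategory I) ⟶ ⟨t.b₁⟩)
    (⟨j', hj'⟩ : (⟨q⟩ : WideSubcategory I) ⟶ ⟨s.a₁⟩)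
    (⟨t.j, t.hj⟩ : (⟨t.b₁⟩ : WideSubcategory I) ⟶ ⟨b⟩)
    (⟨s.i, s.hi⟩ : (⟨s.a₁⟩ : WideSubcategory I) ⟶ ⟨b⟩)
  /-- the corner of the left square -/
  p : U
  /-- the map in `I` of the left square -/
  k'' : p ⟶ t.a₁
  /-- the map in `A` of the left square -/
  α' : p ⟶ q
  hk'' : I k''
  hα' : A α'
  left : IsPullback k'' α' t.α k'
  /-- the corner of the right square -/
  r : U
  /-- the map in `A` of the right square -/
  γ' : q ⟶ r
  /-- the map in `I` of the right square -/
  j'' : r ⟶ s.b₁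
  hγ' : A γ'
  hj'' : I j''
  right : γ' ≫ j'' = j' ≫ s.α

/-- The composite read off from a composition diagram. -/
def CompDiagram.result {a b c : U} {t : ThreeFold I A a b} {s : ThreeFold I A b c}
    (d : CompDiagram t s) : ThreeFold I A a c :=
  ⟨d.p, d.r, d.k'' ≫ t.i, d.α' ≫ d.γ', d.j'' ≫ s.j, I.comp_mem _ _ d.hk'' t.hi,
    A.comp_mem _ _ d.hα' d.hγ', I.comp_mem _ _ d.hj'' s.hj⟩

end ThreeFold

theorem ThreeFold.exists_iso_of_rel {I A : MorphismProperty U} [I.IsMultiplicative] {a b : U}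
    {t s : ThreeFold I A a b} (hts : t ≈ s) :
    ∃ e : t.a₁ ≅ s.a₁, e.hom ≫ s.i = t.i ∧ e.hom ≫ s.reg = t.reg := by
  obtain ⟨φ, ψ, -, -, h1, h2, h3⟩ := hts
  refine ⟨φ, h1, ?_⟩
  rw [reg, ← Category.assoc, h2, Category.assoc, h3, reg]

namespace AdmitsConjugation

open ThreeFold

variable {I A : MorphismProperty U} [I.IsMultiplicative] [A.IsMultiplicative]

theorem nonempty_compDiagram (h : AdmitsConjugation I A) {a b c : U} (t : ThreeFold I A a b) (s : ThreeFold I A b c) :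
    Nonempty (CompDiagram t s) := by
  have := h.indexing.hasPullbacks
  let J : (⟨t.b₁⟩ : WideSubcategory I) ⟶ ⟨b⟩ := ⟨t.j, t.hj⟩
  let K : (⟨s.a₁⟩ : WideSubcategory I) ⟶ ⟨b⟩ := ⟨s.i, s.hi⟩
  have hq := IsPullback.of_hasPullback J K
  obtain ⟨p, k'', α', hk'', hα', hp⟩ :=
    h.exists_pullback t.α (pullback.fst J K).hom t.hα (pullback.fst J K).property
  obtain ⟨r, γ', j'', hγ', hj'', hr⟩ := h.factors ((pullback.snd J K).hom ≫ s.α)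
  exact ⟨⟨_, (pullback.fst J K).hom, (pullback.snd J K).hom, (pullback.fst J K).property,
    (pullback.snd J K).property, hq, p, k'', α', hk'', hα', hp, r, γ', j'', hγ', hj'', hr⟩⟩

/-- A map over a map in `I`, from a map in `I`, is in `I`. -/
theorem mem_of_comp (h : AdmitsConjugation I A) {x y z : U} {f : x ⟶ y} {k : y ⟶ z} (hk : I k) (hfk : I (f ≫ k)) :
    I f := by
  obtain ⟨c, α, i, hα, hi, rfl⟩ := h.factors f
  obtain ⟨e, he, h1, -⟩ := h.lift α (i ≫ k) (𝟙 x) ((α ≫ i) ≫ k) hα (I.comp_mem _ _ hi hk)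
    (A.id_mem _) hfk (by simp)
  rw [Category.id_comp] at h1
  rw [← h1]
  exact I.comp_mem _ _ he.1 hi

theorem isoIn_of_comp (h : AdmitsConjugation I A) {x y z : U} (e : x ≅ y) {k : y ⟶ z} {k' : x ⟶ z} (hk : I k)
    (hk' : I k') (he : e.hom ≫ k = k') : IsoIn I e := by
  refine ⟨h.mem_of_comp hk (by rwa [he]), h.mem_of_comp (k := k') hk' ?_⟩
  rwa [← he, Iso.inv_hom_id_assoc]

theorem mono_of_mem_wide (h : AdmitsConjugation I A) {x y : WideSubcategory I} (f : x ⟶ y) : Mono f := by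
  have := h.indexing.hasPullbacks
  refine ⟨fun {z} g g' hg => ?_⟩
  have hE := h.indexing.isIso_endo (pullback.fst f f ≫ pullback.lift (𝟙 x) (𝟙 x) rfl)
  have h1 : pullback.lift (𝟙 x) (𝟙 x) rfl ≫ pullback.fst f f = 𝟙 x := pullback.lift_fst _ _ _
  have h2 : pullback.lift (𝟙 x) (𝟙 x) rfl ≫ pullback.snd f f = 𝟙 x := pullback.lift_snd _ _ _
  have hi : pullback.fst f f ≫ pullback.lift (𝟙 x) (𝟙 x) rfl = 𝟙 _ := by
    rw [← cancel_epi (pullback.fst f f ≫ pullback.lift (𝟙 x) (𝟙 x) rfl)]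
    simp only [Category.assoc, Category.comp_id]
    rw [← Category.assoc (pullback.lift _ _ _), h1, Category.id_comp]
  have hs : pullback.fst f f = pullback.snd f f := by
    have := hi =≫ pullback.snd f f
    rwa [Category.assoc, h2, Category.comp_id, Category.id_comp] at this
  calc g = pullback.lift g g' hg ≫ pullback.fst f f := (pullback.lift_fst _ _ _).symm
    _ = pullback.lift g g' hg ≫ pullback.snd f f := by rw [hs]
    _ = g' := pullback.lift_snd _ _ _

theorem mono_of_mem (h : AdmitsConjugation I A) {x y : U} {k : x ⟶ y} (hk : I k) : Mono k := by
  refine ⟨fun {z} f g hfg => ?_⟩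
  obtain ⟨c, α, i, hα, hi, rfl⟩ := h.factors f
  obtain ⟨d, β, j, hβ, hj, rfl⟩ := h.factors g
  obtain ⟨e, he, h1, h2⟩ := h.lift α (i ≫ k) β (j ≫ k) hα (I.comp_mem _ _ hi hk) hβ
    (I.comp_mem _ _ hj hk) (by simpa using hfg)
  have hm := h.mono_of_mem_wide (⟨k, hk⟩ : (⟨x⟩ : WideSubcategory I) ⟶ ⟨y⟩)
  have h3 : e.hom ≫ i = j := by
    have := hm.right_cancellation (Z := ⟨d⟩) ⟨e.hom ≫ i, I.comp_mem _ _ he.1 hi⟩ ⟨j, hj⟩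
      (WideSubcategory.hom_ext _ (by simpa using h2))
    exact congrArg InducedWideCategory.Hom.hom this
  rw [← h1, ← h3, Category.assoc]

/-- Pullbacks in `I` are pullbacks in `U`. -/
theorem isPullback_of_wide (h : AdmitsConjugation I A) {q x y b : U} {k : q ⟶ x} {j : q ⟶ y} {f : x ⟶ b} {g : y ⟶ b}
    {hk : I k} {hj : I j} {hf : I f} {hg : I g}
    (H : IsPullback (C := WideSubcategory I)
      (⟨k, hk⟩ : (⟨q⟩ : WideSubcategory I) ⟶ ⟨x⟩) (⟨j, hj⟩ : (⟨q⟩ : WideSubcategory I) ⟶ ⟨y⟩)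
      (⟨f, hf⟩ : (⟨x⟩ : WideSubcategory I) ⟶ ⟨b⟩) (⟨g, hg⟩ : (⟨y⟩ : WideSubcategory I) ⟶ ⟨b⟩)) :
    IsPullback k j f g := by
  have := h.mono_of_mem hk
  have := h.mono_of_mem hg
  have hw : k ≫ f = j ≫ g := congrArg InducedWideCategory.Hom.hom H.w
  refine ⟨⟨hw⟩, ⟨PullbackCone.IsLimit.mk _ (fun s => ?_) ?_ ?_ ?_⟩⟩
  · exact Classical.choose (show ∃ l : s.pt ⟶ q, l ≫ k = s.fst by
      obtain ⟨c, α, i, hα, hi, hi'⟩ := h.factors s.fst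
      obtain ⟨d, β, j', hβ, hj', hj''⟩ := h.factors s.snd
      obtain ⟨e, he, h1, h2⟩ := h.lift α (i ≫ f) β (j' ≫ g) hα (I.comp_mem _ _ hi hf) hβ
        (I.comp_mem _ _ hj' hg) (by
          rw [← Category.assoc, ← Category.assoc, hi', hj'']; exact s.condition)
      let l := H.lift (W := (⟨d⟩ : WideSubcategory I))
        ⟨e.hom ≫ i, I.comp_mem _ _ he.1 hi⟩ ⟨j', hj'⟩
        (WideSubcategory.hom_ext _ (by simpa using h2))
      have hl : l.hom ≫ k = e.hom ≫ i :=
        congrArg InducedWideCategory.Hom.hom (H.lift_fst (W := (⟨d⟩ : WideSubcategory I))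
          ⟨e.hom ≫ i, I.comp_mem _ _ he.1 hi⟩ ⟨j', hj'⟩ _)
      exact ⟨β ≫ l.hom, by rw [Category.assoc, hl, ← Category.assoc, h1, hi']⟩)
  · intro s
    exact Classical.choose_spec (p := fun l : s.pt ⟶ q => l ≫ k = s.fst) _
  · intro s
    rw [← cancel_mono g, Category.assoc, ← hw, ← Category.assoc]
    rw [Classical.choose_spec (p := fun l : s.pt ⟶ q => l ≫ k = s.fst) _]
    exact s.condition
  · intro s m hm _
    rw [← cancel_mono k, hm]
    exact (Classical.choose_spec (p := fun l : s.pt ⟶ q => l ≫ k = s.fst) _).symm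

/-- A diagram is determined up to equivalence by its first leg and the composite of the last
two. -/
theorem rel_of_iso (h : AdmitsConjugation I A) {a b : U} {t s : ThreeFold I A a b} (e : t.a₁ ≅ s.a₁)
    (h1 : e.hom ≫ s.i = t.i) (h2 : e.hom ≫ s.reg = t.reg) : t ≈ s := by
  have he := h.isoIn_of_comp e s.hi t.hi h1
  have he' := h.iso_subset e he
  obtain ⟨ψ, hψ, h3, h4⟩ := h.lift (e.hom ≫ s.α) s.j t.α t.j (A.comp_mem _ _ he'.1 s.hα) s.hj
    t.hα t.hj (by simpa [reg] using h2)
  exact ⟨e, ψ, he, hψ, h1, h3.symm, h4⟩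

/-- The outer part of a composition diagram is a pullback in `U`. -/
theorem compDiagram_isPullback (h : AdmitsConjugation I A) {a b c : U} {t : ThreeFold I A a b} {s : ThreeFold I A b c}
    (d : CompDiagram t s) : IsPullback d.k'' (d.α' ≫ d.j') t.reg s.i :=
  (d.left.flip.paste_horiz (h.isPullback_of_wide d.middle).flip).flip

theorem compDiagram_reg {a b c : U} {t : ThreeFold I A a b} {s : ThreeFold I A b c}
    (d : CompDiagram t s) : d.result.reg = (d.α' ≫ d.j') ≫ s.reg := by
  simp only [reg, CompDiagram.result, Category.assoc]
  rw [← Category.assoc d.γ', d.right, Category.assoc]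

theorem result_rel (h : AdmitsConjugation I A) {a b c : U} {t : ThreeFold I A a b} {s : ThreeFold I A b c}
    (d : CompDiagram t s) {r : ThreeFold I A a c} (e : d.p ≅ r.a₁)
    (h1 : e.hom ≫ r.i = d.k'' ≫ t.i) (h2 : e.hom ≫ r.reg = (d.α' ≫ d.j') ≫ s.reg) :
    d.result ≈ r :=
  h.rel_of_iso (t := d.result) e h1 (h2.trans (compDiagram_reg d).symm)

theorem result_rel_result (h : AdmitsConjugation I A) {a b b' c : U} {t : ThreeFold I A a b} {s : ThreeFold I A b c}
    {t' : ThreeFold I A a b'} {s' : ThreeFold I A b' c}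
    (d : CompDiagram t s) (d' : CompDiagram t' s') (e : d.p ≅ d'.p)
    (h1 : e.hom ≫ d'.k'' ≫ t'.i = d.k'' ≫ t.i)
    (h2 : e.hom ≫ (d'.α' ≫ d'.j') ≫ s'.reg = (d.α' ≫ d.j') ≫ s.reg) :
    d.result ≈ d'.result :=
  h.result_rel d (r := d'.result) e h1 (by rw [compDiagram_reg]; exact h2)

/-- The composite depends neither on the diagrams nor on the representatives chosen. -/
theorem compDiagram_rel (h : AdmitsConjugation I A) {a b c : U} {t t' : ThreeFold I A a b} {s s' : ThreeFold I A b c}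
    (d : CompDiagram t s) (d' : CompDiagram t' s') (ht : t ≈ t') (hs : s ≈ s') :
    d.result ≈ d'.result := by
  obtain ⟨e, h1, h2⟩ := exists_iso_of_rel ht
  obtain ⟨f, h3, h4⟩ := exists_iso_of_rel hs
  have P := h.compDiagram_isPullback d
  have P' := h.compDiagram_isPullback d'
  have Q : IsPullback (d.k'' ≫ e.hom) ((d.α' ≫ d.j') ≫ f.hom) t'.reg s'.i :=
    P.of_iso (Iso.refl _) e f (Iso.refl _) (by simp) (by simp) (by simp [h2]) (by simp [h3])
  refine h.result_rel_result d d' (Q.isoIsPullback _ _ P') ?_ ?_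
  · rw [← Category.assoc, Q.isoIsPullback_hom_fst, Category.assoc, h1]
  · rw [← Category.assoc, Q.isoIsPullback_hom_snd, Category.assoc, h4]

/-- The category `I ∘ A ∘ I^op`, with the same objects as `U`. -/
@[nolint unusedArguments]
structure Conj (_h : AdmitsConjugation I A) : Type v where
  /-- the underlying object of `U` -/
  obj : U

end AdmitsConjugation

namespace AdmitsConjugation

open ThreeFold

variable {I A : MorphismProperty U} [I.IsMultiplicative] [A.IsMultiplicative]

/-- Morphisms of `I ∘ A ∘ I^op`: equivalence classes of three-fold diagrams. -/
def ConjHom (I A : MorphismProperty U) [I.IsMultiplicative] (a b : U) : Type v :=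
  Quotient (ThreeFold.setoid I A a b)

/-- Composition in `I ∘ A ∘ I^op`. -/
noncomputable def conjComp (h : AdmitsConjugation I A) {a b c : U} :
    ConjHom I A a b → ConjHom I A b c → ConjHom I A a c :=
  Quotient.map₂ (fun t s => (h.nonempty_compDiagram t s).some.result)
    (fun _ _ ht _ _ hs => h.compDiagram_rel _ _ ht hs)

theorem conjComp_mk (h : AdmitsConjugation I A) {a b c : U} {t : ThreeFold I A a b}
    {s : ThreeFold I A b c} (d : CompDiagram t s) :
    h.conjComp (Quotient.mk _ t) (Quotient.mk _ s) = Quotient.mk _ d.result :=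
  Quotient.sound (h.compDiagram_rel _ _ (Setoid.refl _) (Setoid.refl _))

theorem conjComp_id (h : AdmitsConjugation I A) {a b : U} (f : ConjHom I A a b) :
    h.conjComp f (Quotient.mk _ (ThreeFold.id I A b)) = f := by
  induction f using Quotient.inductionOn with
  | h t =>
    obtain ⟨d⟩ := h.nonempty_compDiagram t (ThreeFold.id I A b)
    rw [h.conjComp_mk d]
    have P := h.compDiagram_isPullback d
    have hk : IsIso d.k'' := P.isIso_fst_of_isIso (inferInstanceAs (IsIso (𝟙 b)))
    refine Quotient.sound (h.result_rel d (@asIso _ _ _ _ d.k'' hk) rfl ?_)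
    have hid : (ThreeFold.id I A b).reg = (ThreeFold.id I A b).i := Category.comp_id _
    rw [hid]
    exact P.w

theorem id_conjComp (h : AdmitsConjugation I A) {a b : U} (f : ConjHom I A a b) :
    h.conjComp (Quotient.mk _ (ThreeFold.id I A a)) f = f := by
  induction f using Quotient.inductionOn with
  | h t =>
    obtain ⟨d⟩ := h.nonempty_compDiagram (ThreeFold.id I A a) t
    rw [h.conjComp_mk d]
    have P := h.compDiagram_isPullback d
    have hr : (ThreeFold.id I A a).reg = 𝟙 a := Category.comp_id _
    have hk : IsIso (d.α' ≫ d.j') := P.isIso_snd_of_isIso (by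
      rw [hr]; exact inferInstanceAs (IsIso (𝟙 a)))
    refine Quotient.sound (h.result_rel d (@asIso _ _ _ _ (d.α' ≫ d.j') hk) ?_ rfl)
    change (d.α' ≫ d.j') ≫ t.i = d.k'' ≫ 𝟙 a
    rw [← P.w, hr]

theorem conjComp_assoc (h : AdmitsConjugation I A) {a b c d : U} (f : ConjHom I A a b)
    (g : ConjHom I A b c) (k : ConjHom I A c d) :
    h.conjComp (h.conjComp f g) k = h.conjComp f (h.conjComp g k) := by
  induction f using Quotient.inductionOn with
  | h t =>
  induction g using Quotient.inductionOn with
  | h s =>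
  induction k using Quotient.inductionOn with
  | h r =>
    obtain ⟨d₁⟩ := h.nonempty_compDiagram t s
    obtain ⟨d₂⟩ := h.nonempty_compDiagram s r
    obtain ⟨d₃⟩ := h.nonempty_compDiagram d₁.result r
    obtain ⟨d₄⟩ := h.nonempty_compDiagram t d₂.result
    rw [h.conjComp_mk d₁, h.conjComp_mk d₂, h.conjComp_mk d₃, h.conjComp_mk d₄]
    have P₁ := h.compDiagram_isPullback d₁
    have P₂ := h.compDiagram_isPullback d₂
    let k₃ : d₃.p ⟶ d₁.p := d₃.k''
    let y₄ : d₄.p ⟶ d₂.p := d₄.α' ≫ d₄.j'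
    have P₃ : IsPullback k₃ (d₃.α' ≫ d₃.j') ((d₁.α' ≫ d₁.j') ≫ s.reg) r.i := by
      have := h.compDiagram_isPullback d₃
      rwa [compDiagram_reg] at this
    have P₄ : IsPullback d₄.k'' y₄ t.reg (d₂.k'' ≫ s.i) := h.compDiagram_isPullback d₄
    have hw : (k₃ ≫ d₁.α' ≫ d₁.j') ≫ s.reg = (d₃.α' ≫ d₃.j') ≫ r.i := by
      rw [← P₃.w, Category.assoc]
    have S : IsPullback k₃ (P₂.lift _ _ hw) (d₁.α' ≫ d₁.j') d₂.k'' :=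
      IsPullback.of_bot (by rw [P₂.lift_snd]; exact P₃) (P₂.lift_fst _ _ hw).symm P₂
    have R := S.paste_horiz P₁
    refine Quotient.sound (h.result_rel_result d₃ d₄ (R.isoIsPullback _ _ P₄) ?_ ?_)
    · change _ ≫ d₄.k'' ≫ t.i = k₃ ≫ d₁.k'' ≫ t.i
      rw [← Category.assoc, R.isoIsPullback_hom_fst, Category.assoc]
    · let u₂ : d₂.p ⟶ d := d₂.result.reg
      have h2 : u₂ = (d₂.α' ≫ d₂.j') ≫ r.reg := compDiagram_reg d₂
      change (R.isoIsPullback _ _ P₄).hom ≫ y₄ ≫ u₂ = _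
      rw [← Category.assoc (R.isoIsPullback _ _ P₄).hom, R.isoIsPullback_hom_snd, h2,
        ← Category.assoc (P₂.lift _ _ hw), P₂.lift_snd]

noncomputable instance (h : AdmitsConjugation I A) : SmallCategory h.Conj where
  Hom a b := ConjHom I A a.obj b.obj
  id a := Quotient.mk _ (ThreeFold.id I A a.obj)
  comp f g := h.conjComp f g
  id_comp f := h.id_conjComp f
  comp_id f := h.conjComp_id f
  assoc f g k := h.conjComp_assoc f g k

end AdmitsConjugation

end Conj

/-! ### Conjugate pairs and the regular bimodule -/

namespace AdmitsConjugation

open ThreeFold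

variable {U : Type v} [SmallCategory U] {I A : MorphismProperty U} [I.IsMultiplicative]
  [A.IsMultiplicative]

/-- A map of `I ∘ A ∘ I^op` is regular if it lies in the subcategory `U = I ∘ A`, i.e. has a
representative `j ∘ α ∘ 1^*`. The other maps are singular. -/
def IsRegular {a b : U} (f : ConjHom I A a b) : Prop :=
  ∃ (b₁ : U) (α : a ⟶ b₁) (j : b₁ ⟶ b) (hα : A α) (hj : I j),
    f = Quotient.mk _ ⟨a, b₁, 𝟙 a, α, j, I.id_mem a, hα, hj⟩

theorem isRegular_mk_iff (h : AdmitsConjugation I A) {a b : U} (t : ThreeFold I A a b) :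
    IsRegular (Quotient.mk _ t : ConjHom I A a b) ↔ IsIso t.i := by
  constructor
  · rintro ⟨b₁, α, j, hα, hj, hf⟩
    obtain ⟨e, h1, -⟩ := exists_iso_of_rel (Quotient.exact hf)
    rw [← h1]
    exact (inferInstance : IsIso (e.hom ≫ 𝟙 a))
  · intro hi
    have hI := h.isoIn_of_comp (asIso t.i) (I.id_mem a) t.hi (Category.comp_id _)
    have hA := h.iso_subset _ hI
    refine ⟨t.b₁, inv t.i ≫ t.α, t.j, A.comp_mem _ _ hA.2 t.hα, t.hj, Quotient.sound ?_⟩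
    refine h.rel_of_iso (asIso t.i) (Category.comp_id _) ?_
    simp [reg]

/-- The three-fold diagram of a map in `A`. -/
def ofA {a b : U} (α : a ⟶ b) (hα : A α) : ThreeFold I A a b :=
  ⟨a, b, 𝟙 a, α, 𝟙 b, I.id_mem a, hα, I.id_mem b⟩

theorem isRegular_of_ofA_comp (h : AdmitsConjugation I A) {a b c : U} (α : a ⟶ b) (hα : A α)
    (f : ConjHom I A b c)
    (hf : IsRegular (h.conjComp (Quotient.mk _ (ofA α hα)) f)) : IsRegular f := by
  induction f using Quotient.inductionOn with
  | h s =>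
    obtain ⟨d⟩ := h.nonempty_compDiagram (ofA (I := I) α hα) s
    rw [h.conjComp_mk d] at hf
    let k : d.p ⟶ a := d.k''
    have h1 : IsIso (k ≫ 𝟙 a) := (h.isRegular_mk_iff d.result).1 hf
    have hk : IsIso k := by rwa [Category.comp_id] at h1
    have hA := h.iso_subset _
      (h.isoIn_of_comp (asIso k) (I.id_mem a) d.hk'' (Category.comp_id _))
    have P : IsPullback k (d.α' ≫ d.j') (α ≫ 𝟙 b) s.i := h.compDiagram_isPullback d
    obtain ⟨e, -, -, he⟩ := h.lift α (𝟙 b) (inv k ≫ d.α') (d.j' ≫ s.i) hα (I.id_mem _)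
      (A.comp_mem _ _ hA.2 d.hα') (I.comp_mem _ _ d.hj' s.hi)
      (by rw [Category.assoc, IsIso.eq_inv_comp, P.w, Category.assoc])
    have := h.mono_of_mem s.hi
    have : IsSplitEpi s.i := ⟨⟨⟨e.inv ≫ d.j', by
      rw [Category.assoc, ← he, Category.comp_id, e.inv_hom_id]⟩⟩⟩
    exact (h.isRegular_mk_iff s).2 (isIso_of_mono_of_isSplitEpi _)

theorem isRegular_of_comp (h : AdmitsConjugation I A) {a b c : U} (f : ConjHom I A a b)
    (g : ConjHom I A b c) (hf : IsRegular (h.conjComp f g)) : IsRegular f := by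
  induction f using Quotient.inductionOn with
  | h t =>
  induction g using Quotient.inductionOn with
  | h s =>
    obtain ⟨d⟩ := h.nonempty_compDiagram t s
    rw [h.conjComp_mk d] at hf
    have h1 : IsIso (d.k'' ≫ t.i) := (h.isRegular_mk_iff d.result).1 hf
    have := h.mono_of_mem t.hi
    have : IsSplitEpi t.i := ⟨⟨⟨inv (d.k'' ≫ t.i) ≫ d.k'', by
      rw [Category.assoc, IsIso.inv_hom_id]⟩⟩⟩
    exact (h.isRegular_mk_iff t).2 (isIso_of_mono_of_isSplitEpi _)

theorem ofA_comp (h : AdmitsConjugation I A) {a b c : U} (α : a ⟶ b) (hα : A α) (β : b ⟶ c)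
    (hβ : A β) : (Quotient.mk _ (ofA (α ≫ β) (A.comp_mem _ _ hα hβ)) : ConjHom I A a c) =
      h.conjComp (Quotient.mk _ (ofA α hα)) (Quotient.mk _ (ofA β hβ)) := by
  obtain ⟨d⟩ := h.nonempty_compDiagram (ofA (I := I) α hα) (ofA β hβ)
  rw [h.conjComp_mk d]
  let k : d.p ⟶ a := d.k''
  let y : d.p ⟶ b := d.α' ≫ d.j'
  have P : IsPullback k y (α ≫ 𝟙 b) (𝟙 b) := h.compDiagram_isPullback d
  have hk : IsIso k := P.isIso_fst_of_isIso
  refine (Quotient.sound (h.result_rel d (r := ofA (α ≫ β) _) (@asIso _ _ _ _ k hk) rfl ?_)).symm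
  change k ≫ (α ≫ β) ≫ 𝟙 c = y ≫ β ≫ 𝟙 c
  have := P.w
  rw [Category.comp_id, Category.comp_id] at this
  rw [← this]
  simp

/-- The inclusion of the subcategory `A` in `I ∘ A ∘ I^op`. -/
noncomputable def inclusionA (h : AdmitsConjugation I A) : WideSubcategory A ⥤ h.Conj where
  obj a := ⟨a.obj⟩
  map α := (Quotient.mk _ (ofA α.hom α.property) : ConjHom I A _ _)
  map_id _ := rfl
  map_comp α β := h.ofA_comp α.hom α.property β.hom β.property

/-- `U(a, b)_+`: the regular maps `a ⟶ b` together with a disjoint basepoint, which stands for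
the singular maps. -/
def regularSet (h : AdmitsConjugation I A) (a b : h.Conj) : Pointed.{v} :=
  ⟨Option {f : a ⟶ b // IsRegular f}, none⟩

open Classical in
/-- The quotient map sending the singular maps to the basepoint. -/
noncomputable def toRegularSet (h : AdmitsConjugation I A) {a b : h.Conj} (f : a ⟶ b) :
    h.regularSet a b :=
  if hf : IsRegular f then some ⟨f, hf⟩ else none

/-- The based map induced by `f ↦ φ f` on regular maps. -/
noncomputable def regularSetMap (h : AdmitsConjugation I A) {a b a' b' : h.Conj}
    (φ : (a ⟶ b) → (a' ⟶ b')) : h.regularSet a b ⟶ h.regularSet a' b' where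
  toFun x := Option.elim x none fun f => h.toRegularSet (φ f.1)
  map_point := rfl

theorem regularSetMap_toRegularSet (h : AdmitsConjugation I A) {a b a' b' : h.Conj}
    (φ : (a ⟶ b) → (a' ⟶ b')) (hφ : ∀ f, IsRegular (φ f) → IsRegular f) (f : a ⟶ b) :
    (h.regularSetMap φ).toFun (h.toRegularSet f) = h.toRegularSet (φ f) := by
  by_cases hf : IsRegular f
  · have h1 : h.toRegularSet f = some ⟨f, hf⟩ := dif_pos hf
    rw [h1]
    rfl
  · have h1 : h.toRegularSet f = none := dif_neg hf
    have h2 : h.toRegularSet (φ f) = none := dif_neg (fun h' => hf (hφ f h'))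
    rw [h1, h2]
    rfl

theorem regularSetMap_id (h : AdmitsConjugation I A) {a b : h.Conj}
    (φ : (a ⟶ b) → (a ⟶ b)) (hφ : ∀ f, φ f = f) : h.regularSetMap φ = 𝟙 _ := by
  refine Pointed.Hom.ext (funext fun x => ?_)
  cases x with
  | none => rfl
  | some f =>
    change h.toRegularSet (φ f.1) = some f
    rw [hφ]
    exact dif_pos f.2

theorem regularSetMap_comp (h : AdmitsConjugation I A) {a b a' b' a'' b'' : h.Conj}
    (φ : (a ⟶ b) → (a' ⟶ b')) (ψ : (a' ⟶ b') → (a'' ⟶ b''))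
    (χ : (a ⟶ b) → (a'' ⟶ b''))
    (hψ : ∀ f, IsRegular (ψ f) → IsRegular f) (hχ : ∀ f, χ f = ψ (φ f)) :
    h.regularSetMap χ = h.regularSetMap φ ≫ h.regularSetMap ψ := by
  refine Pointed.Hom.ext (funext fun x => ?_)
  cases x with
  | none => rfl
  | some f =>
    change h.toRegularSet (χ f.1) = (h.regularSetMap ψ).toFun (h.toRegularSet (φ f.1))
    rw [regularSetMap_toRegularSet h ψ hψ, hχ]

/-- The bimodule `U_+ : A^op × (I ∘ A ∘ I^op) ⥤ Sets_*`. A map `α` of `A` acts by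
precomposition and a map `β` of `I ∘ A ∘ I^op` by postcomposition. -/
noncomputable def bimodule (h : AdmitsConjugation I A) :
    (WideSubcategory A)ᵒᵖ ⥤ h.Conj ⥤ Pointed.{v} where
  obj a :=
    { obj := fun b => h.regularSet (h.inclusionA.obj a.unop) b
      map := fun β => h.regularSetMap fun γ => γ ≫ β
      map_id := fun b => h.regularSetMap_id _ fun f => Category.comp_id f
      map_comp := fun β β' => h.regularSetMap_comp _ _ _
        (fun f => h.isRegular_of_comp f β') (fun f => (Category.assoc f β β').symm) }
  map α :=
    { app := fun b => h.regularSetMap fun γ => h.inclusionA.map α.unop ≫ γ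
      naturality := fun b b' β =>
        (h.regularSetMap_comp _ _ (fun γ => h.inclusionA.map α.unop ≫ γ ≫ β)
          (fun f => h.isRegular_of_ofA_comp _ α.unop.property f) (fun _ => rfl)).symm.trans
        (h.regularSetMap_comp _ _ (fun γ => h.inclusionA.map α.unop ≫ γ ≫ β)
          (fun f => h.isRegular_of_comp f β)
          (fun f => (Category.assoc (h.inclusionA.map α.unop) f β).symm)) }
  map_id a := by
    ext b : 2
    refine h.regularSetMap_id _ fun f => ?_
    rw [unop_id, h.inclusionA.map_id, Category.id_comp]
  map_comp {a a' a''} α α' := by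
    ext b : 2
    refine h.regularSetMap_comp (fun γ => h.inclusionA.map α.unop ≫ γ)
      (fun γ => h.inclusionA.map α'.unop ≫ γ) _
      (fun f => h.isRegular_of_ofA_comp _ α'.unop.property f) (fun f => ?_)
    rw [unop_comp, h.inclusionA.map_comp, Category.assoc]

end AdmitsConjugation

/-- A conjugate pair `(𝓑, 𝓐)` arising from a factorization `U = I ∘ A` admitting conjugation:
`𝓑` is equivalent to `I ∘ A ∘ I^op`, and `𝓐` is (isomorphic to) the subcategory `A` of `U`. -/
structure ConjugatePair (𝓑 𝓐 : Type v) [SmallCategory 𝓑] [SmallCategory 𝓐] where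
  /-- the category that factors -/
  U : Type v
  /-- the category structure on `U` -/
  [category : SmallCategory U]
  /-- the maps of the indexing category -/
  I : MorphismProperty U
  /-- the maps of the other factor -/
  A : MorphismProperty U
  [multiplicative_I : I.IsMultiplicative]
  [multiplicative_A : A.IsMultiplicative]
  admits : AdmitsConjugation I A
  /-- `𝓑` is equivalent to `I ∘ A ∘ I^op` -/
  equivB : 𝓑 ≌ admits.Conj
  /-- `𝓐` is isomorphic to `A`, through an equivalence which is bijective on objects -/
  isoA : 𝓐 ≌ WideSubcategory A
  bijective_isoA : Function.Bijective isoA.functor.obj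

attribute [instance] ConjugatePair.category ConjugatePair.multiplicative_I
  ConjugatePair.multiplicative_A

/-- The regular bimodule of a conjugate pair. -/
noncomputable def ConjugatePair.regularBimodule {𝓑 𝓐 : Type v} [SmallCategory 𝓑]
    [SmallCategory 𝓐] (P : ConjugatePair 𝓑 𝓐) : 𝓐ᵒᵖ ⥤ 𝓑 ⥤ Pointed.{v} :=
  P.isoA.functor.op ⋙ P.admits.bimodule ⋙
    (Functor.whiskeringLeft _ _ _).obj P.equivB.functor

/-! ### Model categories -/

/-- A model category is cofibrantly generated if there are sets `I` and `J` of maps permitting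
the small object argument such that the trivial fibrations are the maps with the right lifting
property with respect to `I`, and the fibrations those with respect to `J`. -/
def IsCofibrantlyGenerated (C : Type u) [Category.{v} C] [ModelCategory C] : Prop :=
  ∃ I J : MorphismProperty C,
    MorphismProperty.HasSmallObjectArgument.{v} I ∧
    MorphismProperty.HasSmallObjectArgument.{v} J ∧
    trivialFibrations C = I.rlp ∧ fibrations C = J.rlp

/-- A model category is proper if weak equivalences are stable under pushouts along cofibrations
and under pullbacks along fibrations. -/
structure IsProper (C : Type u) [Category.{v} C] [ModelCategory C] : Prop where
  left {X Y Z W : C} {f : X ⟶ Y} {i : X ⟶ Z} {i' : Y ⟶ W} {f' : Z ⟶ W} :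
    IsPushout f i i' f' → WeakEquivalence f → Cofibration i → WeakEquivalence f'
  right {X Y Z W : C} {f' : X ⟶ Y} {p' : X ⟶ Z} {p : Y ⟶ W} {f : Z ⟶ W} :
    IsPullback f' p' p f → WeakEquivalence f → Fibration p → WeakEquivalence f'

/-- The standing conventions on model categories. -/
structure ModelConventions (C : Type u) [Category.{v} C] [ModelCategory C] : Prop where
  cofibrantlyGenerated : IsCofibrantlyGenerated C
  proper : IsProper C
  fibration_fst (X Y : C) : Fibration (prod.fst : X ⨯ Y ⟶ X)
  fibration_snd (X Y : C) : Fibration (prod.snd : X ⨯ Y ⟶ Y)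
  weakEquivalence_prod {X Y Z W : C} (f : X ⟶ Y) (g : Z ⟶ W) : Fibration f →
    WeakEquivalence f → Fibration g → WeakEquivalence g → WeakEquivalence (prod.map f g)
  weakEquivalence_coprod {X Y Z W : C} (f : X ⟶ Y) (g : Z ⟶ W) : Cofibration f →
    WeakEquivalence f → Cofibration g → WeakEquivalence g → WeakEquivalence (coprod.map f g)

/-- The projective model structure on `[𝓓ᵒᵖ, C]`: fibrations and weak equivalences are defined
objectwise. This determines the cofibrations. -/
structure IsProjective (𝓓 : Type v) [SmallCategory 𝓓] (C : Type u) [Category.{v} C]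
    [ModelCategory C] [ModelCategory (𝓓ᵒᵖ ⥤ C)] : Prop where
  fibration_iff {F G : 𝓓ᵒᵖ ⥤ C} (τ : F ⟶ G) : Fibration τ ↔ ∀ d, Fibration (τ.app d)
  weakEquivalence_iff {F G : 𝓓ᵒᵖ ⥤ C} (τ : F ⟶ G) :
    WeakEquivalence τ ↔ ∀ d, WeakEquivalence (τ.app d)

/-- An adjunction `L ⊣ R` between model categories is a Quillen pair if `L` preserves
cofibrations and trivial cofibrations. -/
structure IsQuillenPair {M N : Type*} [Category* M] [Category* N] [ModelCategory M]
    [ModelCategory N] {L : M ⥤ N} {R : N ⥤ M} (_adj : L ⊣ R) : Prop where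
  cofibration {X Y : M} (f : X ⟶ Y) : Cofibration f → Cofibration (L.map f)
  trivialCofibration {X Y : M} (f : X ⟶ Y) : Cofibration f → WeakEquivalence f →
    Cofibration (L.map f) ∧ WeakEquivalence (L.map f)

end Conjugation

/-! The Quillen condition is checked on the right adjoint. If `𝓡` preserves fibrations and trivial
fibrations, then lifting problems transpose along `𝓛 ⊣ 𝓡`, and `𝓛` preserves cofibrations and
trivial cofibrations (`IsQuillenPair.of_rightAdjoint`). In the projective structures both conditions
on `𝓡` are objectwise.

The core is that, for fixed `b`, the based functor `U_+(-, b)` on `A` is free (`bimodule_isFreeOn`).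
A regular map into `b` is a map of `U`, and it factors as a map `α` of `A` followed by a map `j` of
`I`, uniquely up to isomorphisms of `I`. Choose one representative `j : c ⟶ b` in each isomorphism
class of maps of `I` into `b`. Then every regular map is `α ≫ j` for exactly one representative `j`,
and for exactly one `α` because maps of `I` are monomorphisms. Hence `U_+(-, b)` is a disjoint union
of representables `A(-, c)` with a basepoint added. By the Yoneda lemma, `𝓡 G b` is the product of
the objects `G c` (`IsFreeOn.isLimitFan`), and `𝓡` acts on maps as the corresponding product.
Fibrations and trivial fibrations are right lifting classes, hence closed under products.

The projective structures come from the small object argument applied to the free maps on the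
generators of `C`. The free functor on `X` at `l` takes at `k` the value of a coproduct of copies of
`X` indexed by `l ⟶ k`. Evaluation therefore turns free cells into cells of `C`, and smallness is
inherited from `C`. The remaining point is that maps lifting against all objectwise fibrations are
objectwise weak equivalences. It follows from the right adjoint of evaluation, whose values are
products (`llp_functorCategory_fibrations_le`), and a retract argument then identifies the trivial
cofibrations. -/

namespace CategoryTheory.MorphismProperty

/-! ### Cells in functor categories -/

universe w

/-- A colimit cocone over a discrete diagram, as a colimit cofan. -/
def isColimitCofanOfDiscrete {C : Type u} [Category.{v} C] {J : Type w} {X : Discrete J ⥤ C}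
    {c : Cocone X} (h : IsColimit c) :
    IsColimit (Cofan.mk (f := fun j => X.obj ⟨j⟩) c.pt fun j => c.ι.app ⟨j⟩) :=
  Cofan.IsColimit.mk _ (fun s => h.desc ⟨s.pt, Discrete.natTrans fun j => s.inj j.as⟩)
    (fun _ _ => h.fac _ _) (fun s _ hm => h.hom_ext fun j =>
      (hm j.as).trans (h.fac ⟨s.pt, Discrete.natTrans fun j => s.inj j.as⟩ j).symm)

/-- A coproduct over `j` of coproducts over `T j` is a single coproduct over the pairs `(j, t)`. -/
theorem colimitsOfShape_coproducts_le {C : Type u} [Category.{v} C] (W : MorphismProperty C)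
    (J : Type w) : (coproducts.{w} W).colimitsOfShape (Discrete J) ≤ coproducts.{w} W := by
  rintro _ _ _ ⟨X₁, X₂, c₁, c₂, h₁, h₂, f, hf⟩
  -- Membership is restated with explicit cofans, so that index types, inclusions and maps can be
  -- chosen simultaneously for all `j` and the cofans composed.
  have H : ∀ {A B : C} (g : A ⟶ B), coproducts.{w} W g → ∃ (T : Type w) (Y₁ Y₂ : T → C)
      (i₁ : ∀ t, Y₁ t ⟶ A) (i₂ : ∀ t, Y₂ t ⟶ B) (_ : IsColimit (Cofan.mk _ i₁))
      (_ : IsColimit (Cofan.mk _ i₂)) (φ : ∀ t, Y₁ t ⟶ Y₂ t), (∀ t, W (φ t)) ∧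
        ∀ t, i₁ t ≫ g = φ t ≫ i₂ t := by
    intro A B g hg
    obtain ⟨T, ⟨Z₁, Z₂, d₁, d₂, k₁, k₂, φ, hφ⟩⟩ := (coproducts_iff _ _).1 hg
    exact ⟨T, fun t => Z₁.obj ⟨t⟩, fun t => Z₂.obj ⟨t⟩, fun t => d₁.ι.app ⟨t⟩,
      fun t => d₂.ι.app ⟨t⟩, isColimitCofanOfDiscrete k₁, isColimitCofanOfDiscrete k₂,
      fun t => φ.app ⟨t⟩, fun t => hφ _, fun t => k₁.fac _ _⟩
  choose T Y₁ Y₂ i₁ i₂ k₁ k₂ g hg hi using fun j : J => H (f.app ⟨j⟩) (hf ⟨j⟩)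
  refine colimitsOfShape_le_coproducts W (Σ j, T j) _
    (colimitsOfShape.mk' _ _ _ _
      (Cofan.isColimitTrans _ (isColimitCofanOfDiscrete h₁) _ k₁)
      (Cofan.isColimitTrans _ (isColimitCofanOfDiscrete h₂) _ k₂)
      (Discrete.natTrans fun p => g p.as.1 p.as.2) (fun p => hg _ _) _ ?_)
  rintro ⟨j, t⟩
  have := h₁.fac (Cocone.mk _ (f ≫ c₂.ι)) ⟨j⟩
  have h2 := hi j t
  dsimp at this h2 ⊢
  simp [this, reassoc_of% h2]

variable {C : Type u} [Category.{v} C] (W : MorphismProperty C)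
  (K : Type v) [SmallCategory K]

section

variable [HasCoproducts.{v} C]

/-- The maps of `K ⥤ C` freely generated at an object of `K` by a map in `W`. -/
def freeMaps : MorphismProperty (K ⥤ C) :=
  ofHoms fun p : W.toSet × K => (evaluationLeftAdjoint C p.2).map p.1.1.hom

instance [IsSmall.{v} W] : IsSmall.{v} (W.freeMaps K) := by
  dsimp only [freeMaps]
  infer_instance

/-- Lifting `τ` against the free map on `i` at `k` is, by the adjunction with evaluation at `k`, the
same as lifting `τ.app k` against `i`. -/
theorem rlp_freeMaps : (W.freeMaps K).rlp = W.rlp.functorCategory K := by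
  ext F G τ
  constructor
  · intro h k A B i hi
    have := h _ (ofHoms.mk (⟨⟨CategoryTheory.Arrow.mk i, hi⟩, k⟩ : W.toSet × K))
    exact ((evaluationAdjunctionRight C k).hasLiftingProperty_iff i τ).1 this
  · rintro h _ _ _ ⟨⟨⟨i, hi⟩, k⟩⟩
    exact ((evaluationAdjunctionRight C k).hasLiftingProperty_iff i.hom τ).2 (h k _ hi)

/-- The free map on `f` at `l`, evaluated at `k`, is the coproduct of copies of `f` indexed by `l ⟶
k`. -/
theorem freeMaps_le_inverseImage_coproducts (k : K) :
    W.freeMaps K ≤ (coproducts.{v} W).inverseImage ((evaluation K C).obj k) := by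
  rintro _ _ _ ⟨⟨⟨f, hf⟩, l⟩⟩
  refine colimitsOfShape_le_coproducts W (l ⟶ k) _
    (colimitsOfShape.mk' _ _ _ _ (coproductIsCoproduct fun _ : l ⟶ k => f.left)
      (coproductIsCoproduct fun _ : l ⟶ k => f.right)
      (Discrete.natTrans fun _ => f.hom) (fun _ => hf) _ ?_)
  rintro ⟨g⟩
  simp

theorem coproducts_freeMaps_le (k : K) : coproducts.{v} (W.freeMaps K) ≤
    (coproducts.{v} W).inverseImage ((evaluation K C).obj k) := by
  intro X Y f hf
  obtain ⟨J, ⟨X₁, X₂, c₁, c₂, h₁, h₂, φ, hφ⟩⟩ := (coproducts_iff _ _).1 hf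
  refine colimitsOfShape_coproducts_le W J _
    (colimitsOfShape.mk' (X₁ ⋙ (evaluation K C).obj k) (X₂ ⋙ (evaluation K C).obj k) _ _
      (isColimitOfPreserves ((evaluation K C).obj k) h₁)
      (isColimitOfPreserves ((evaluation K C).obj k) h₂)
      (Functor.whiskerRight φ _) (fun j => W.freeMaps_le_inverseImage_coproducts K k _ (hφ j)) _ ?_)
  intro j
  exact congr_app (h₁.fac (Cocone.mk _ (φ ≫ c₂.ι)) j) k

/-- Evaluation preserves coproducts and pushouts. Attaching free cells to a functor thus attaches
ordinary `W`-cells to each of its values, so evaluation carries relative free cell complexes to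
relative `W`-cell complexes. -/
theorem pushouts_coproducts_freeMaps_le [HasPushouts C] (k : K) :
    (coproducts.{v} (W.freeMaps K)).pushouts ≤
      (coproducts.{v} W).pushouts.inverseImage ((evaluation K C).obj k) := by
  rintro X Y f ⟨_, _, g, _, _, hg, sq⟩
  exact ⟨_, _, _, _, _, W.coproducts_freeMaps_le K k _ hg, sq.map ((evaluation K C).obj k)⟩

/-! ### Smallness of free functors -/

/-- `Hom(L A, -)` as the composite of `Hom(A, -)` with the right adjoint `R` of `L`. -/
def coyonedaObjIsoOfAdjunction {D : Type*} [Category.{v} D] {L : C ⥤ D} {R : D ⥤ C}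
    (adj : L ⊣ R) (A : C) : coyoneda.obj (Opposite.op (L.obj A)) ≅ R ⋙ coyoneda.obj (Opposite.op A) :=
  NatIso.ofComponents (fun X => (adj.homEquiv A X).toIso) fun {X Y} f => by
    ext g
    exact adj.homEquiv_naturality_right g f

end

/-- Maps out of the free functor on `A` at `k` are maps from `A` to the value at `k`. Since
evaluation preserves colimits and sends free cell complexes to `W`-cell complexes, smallness of `A`
with respect to `W` gives smallness of the free functor, with the same cardinal. -/
instance isCardinalForSmallObjectArgument_freeMaps [HasColimits C] (κ : Cardinal.{v})
    [Fact κ.IsRegular] [OrderBot κ.ord.ToType] [W.IsCardinalForSmallObjectArgument κ] :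
    (W.freeMaps K).IsCardinalForSmallObjectArgument κ where
  isSmall := by
    have := SmallObject.isSmall W κ
    infer_instance
  preservesColimit {A B X Y} i hi f hf := by
    obtain ⟨⟨⟨i₀, hi₀⟩, k⟩⟩ := hi
    -- The given cell complex evaluated at `k`. Only the existence of a cell decomposition of each
    -- stage is known, so one is chosen.
    let c : RelativeCellComplex.{v} (fun _ : κ.ord.ToType => W.homFamily) (f.app k) :=
      { (hf.toTransfiniteCompositionOfShape.map ((evaluation K C).obj k)) with
        attachCells := fun j hj => by
          refine Nonempty.some ((nonempty_attachCells_iff _ _).2 ?_)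
          rw [ofHoms_homFamily]
          refine W.pushouts_coproducts_freeMaps_le K k _ ?_
          have := (hf.attachCells j hj).pushouts_coproducts
          rwa [ofHoms_homFamily] at this }
    have h₁ : PreservesColimit (hf.F ⋙ (evaluation K C).obj k) (coyoneda.obj (Opposite.op i₀.left)) :=
      SmallObject.preservesColimit W κ i₀.hom hi₀ (f.app k) c
    exact preservesColimit_of_natIso _
      (coyonedaObjIsoOfAdjunction (evaluationAdjunctionRight C k) i₀.left).symm

theorem hasSmallObjectArgument_freeMaps [HasColimits C] [HasSmallObjectArgument.{v} W] :
    HasSmallObjectArgument.{v} (W.freeMaps K) := by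
  obtain ⟨κ, h, h', _⟩ := HasSmallObjectArgument.exists_cardinal (I := W)
  exact ⟨κ, h, h', inferInstance⟩

end CategoryTheory.MorphismProperty

namespace Conjugation

open MorphismProperty

/-! ### The projective model structure -/

section Projective

variable {C : Type u} [Category.{v} C] [ModelCategory C] (K : Type v) [SmallCategory K]

/-- Trivial fibrations are the maps with the right lifting property against cofibrations, and lifts
into a product are found one factor at a time. -/
instance : (trivialFibrations C).IsStableUnderProductsOfShape K := by
  rw [← cofibrations_rlp]
  infer_instance

instance : (fibrations C).IsStableUnderProductsOfShape K := by
  rw [← trivialCofibrations_rlp]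
  infer_instance

variable [HasLimits C]

/-- A map of functors with the left lifting property against the objectwise fibrations is an
objectwise trivial cofibration. -/
theorem llp_functorCategory_fibrations_le :
    ((fibrations C).functorCategory K).llp ≤ (trivialCofibrations C).functorCategory K := by
  intro F G τ hτ k
  rw [← fibrations_llp]
  intro X Y p hp
  -- Transposing along the right adjoint of evaluation at `k`, it remains to see that this adjoint
  -- sends `p` to an objectwise fibration. Its value at `l` is the product of copies of `p` indexed
  -- by `l ⟶ k`.
  refine ((evaluationAdjunctionLeft C k).hasLiftingProperty_iff τ p).2 (hτ _ fun l => ?_)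
  refine limitsOfShape_le _ (limitsOfShape.mk' _ _ _ _ (productIsProduct fun _ : l ⟶ k => X)
    (productIsProduct fun _ : l ⟶ k => Y) (Discrete.natTrans fun _ => p) (fun _ => hp) _ ?_)
  rintro ⟨g⟩
  simp

/-- The free maps on the two generating sets detect the objectwise trivial fibrations and the
objectwise fibrations, and the small object argument provides both factorizations. What has to be
proved by hand is that the left class of the second factorization system consists exactly of the
trivial cofibrations. -/
theorem exists_projective [HasColimits C] (hC : IsCofibrantlyGenerated C) (𝓓 : Type v) [SmallCategory 𝓓] :
    ∃ _ : ModelCategory (𝓓ᵒᵖ ⥤ C), IsProjective 𝓓 C := by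
  obtain ⟨I, J, hI, hJ, hI', hJ'⟩ := hC
  let K := 𝓓ᵒᵖ
  let _ : CategoryWithFibrations (𝓓ᵒᵖ ⥤ C) := ⟨(fibrations C).functorCategory K⟩
  let _ : CategoryWithWeakEquivalences (𝓓ᵒᵖ ⥤ C) := ⟨(weakEquivalences C).functorCategory K⟩
  let _ : CategoryWithCofibrations (𝓓ᵒᵖ ⥤ C) := ⟨((trivialFibrations C).functorCategory K).llp⟩
  have hfib : fibrations (𝓓ᵒᵖ ⥤ C) = (J.freeMaps K).rlp := by
    rw [rlp_freeMaps, ← hJ']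
    rfl
  have htf : trivialFibrations (𝓓ᵒᵖ ⥤ C) = (trivialFibrations C).functorCategory K := by
    ext F G τ
    exact ⟨fun h k => ⟨h.1 k, h.2 k⟩, fun h => ⟨fun k => (h k).1, fun k => (h k).2⟩⟩
  have htf' : trivialFibrations (𝓓ᵒᵖ ⥤ C) = (I.freeMaps K).rlp := by
    rw [rlp_freeMaps, ← hI', htf]
  have hcof : cofibrations (𝓓ᵒᵖ ⥤ C) = (I.freeMaps K).rlp.llp := by
    rw [← htf', htf]
    rfl
  have := I.hasSmallObjectArgument_freeMaps K
  have := J.hasSmallObjectArgument_freeMaps K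
  have h23 : (weakEquivalences (𝓓ᵒᵖ ⥤ C)).HasTwoOutOfThreeProperty :=
    { comp_mem := fun f g hf hg k => (weakEquivalences C).comp_mem _ _ (hf k) (hg k)
      of_postcomp := fun f g hg hfg k =>
        (weakEquivalences C).of_postcomp (f.app k) (g.app k) (hg k) (hfg k)
      of_precomp := fun f g hf hfg k =>
        (weakEquivalences C).of_precomp (f.app k) (g.app k) (hf k) (hfg k) }
  have w₁ : IsWeakFactorizationSystem (cofibrations (𝓓ᵒᵖ ⥤ C)) (trivialFibrations (𝓓ᵒᵖ ⥤ C)) := by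
    rw [hcof, htf']
    exact ⟨rlp_llp_rlp _, rfl, inferInstance⟩
  -- Lifting against all fibrations includes lifting against the trivial ones, hence a cofibration;
  -- the weak equivalence is objectwise, from the previous theorem.
  have hle : (fibrations (𝓓ᵒᵖ ⥤ C)).llp ≤ trivialCofibrations (𝓓ᵒᵖ ⥤ C) := fun F G τ hτ =>
    ⟨by
      rw [← llp_eq_of_wfs (cofibrations (𝓓ᵒᵖ ⥤ C)) (trivialFibrations (𝓓ᵒᵖ ⥤ C))]
      exact antitone_llp (trivialFibrations_sub_fibrations _) _ hτ,
    fun k => (llp_functorCategory_fibrations_le K _ hτ k).2⟩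
  have hf : HasFactorization (fibrations (𝓓ᵒᵖ ⥤ C)).llp (fibrations (𝓓ᵒᵖ ⥤ C)) := by
    rw [hfib]
    infer_instance
  have htc : trivialCofibrations (𝓓ᵒᵖ ⥤ C) = (fibrations (𝓓ᵒᵖ ⥤ C)).llp := by
    refine le_antisymm (fun F G τ hτ => ?_) hle
    -- Retract argument: in this factorization of a trivial cofibration `τ`, the fibration `d.p` is
    -- trivial by two out of three. So `τ` lifts against it and is a retract of `d.i`.
    let d := factorizationData (fibrations (𝓓ᵒᵖ ⥤ C)).llp (fibrations (𝓓ᵒᵖ ⥤ C)) τ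
    have hp : trivialFibrations (𝓓ᵒᵖ ⥤ C) d.p :=
      ⟨d.hp, of_precomp _ _ _ (hle _ d.hi).2 (by rw [d.fac]; exact hτ.2)⟩
    have := hasLiftingProperty_of_wfs τ d.p hτ.1 hp
    exact of_retract (RetractArrow.ofLeftLiftingProperty d.fac) d.hi
  have w₂ : IsWeakFactorizationSystem (trivialCofibrations (𝓓ᵒᵖ ⥤ C)) (fibrations (𝓓ᵒᵖ ⥤ C)) := by
    rw [htc, hfib]
    exact ⟨rlp_llp_rlp _, rfl, inferInstance⟩
  let m : ModelCategory (𝓓ᵒᵖ ⥤ C) := ModelCategory.mk' _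
  refine ⟨m, ?_⟩
  constructor
  · intro F G τ
    simp only [fibration_iff]
    rfl
  · intro F G τ
    simp only [weakEquivalence_iff]
    rfl

end Projective

end Conjugation

namespace Conjugation

/-! ### Free based functors and the right adjoint -/

section Free

variable {𝓐 : Type v} [SmallCategory 𝓐]

/-- A based functor `Q : 𝓐ᵒᵖ ⥤ Sets_*` is free on elements `gen j : Q (obj j)` if every element
other than the basepoints is, in a unique way, a restriction of one of them. -/
structure IsFreeOn (Q : 𝓐ᵒᵖ ⥤ Pointed.{v}) {J : Type v} (obj : J → 𝓐)
    (gen : ∀ j, Q.obj (op (obj j))) : Prop where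
  ne_point {a : 𝓐} (j : J) (f : a ⟶ obj j) :
    (Q.map f.op).toFun (gen j) ≠ (Q.obj (op a)).point
  exists_eq {a : 𝓐} (q : Q.obj (op a)) : q ≠ (Q.obj (op a)).point →
    ∃ (j : J) (f : a ⟶ obj j), (Q.map f.op).toFun (gen j) = q
  unique {a : 𝓐} {j j' : J} (f : a ⟶ obj j) (f' : a ⟶ obj j') :
    (Q.map f.op).toFun (gen j) = (Q.map f'.op).toFun (gen j') →
      (⟨j, f⟩ : Σ j, (a ⟶ obj j)) = ⟨j', f'⟩

/-- Transposition along `e` is a bijection between maps `e.functor.obj a ⟶ obj j` and maps `a ⟶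
e.inverse.obj (obj j)`, so representables pull back to representables. The counit carries the
generators along. -/
theorem IsFreeOn.precomp_equivalence {𝓐' : Type v} [SmallCategory 𝓐'] {Q : 𝓐'ᵒᵖ ⥤ Pointed.{v}}
    {J : Type v} {obj : J → 𝓐'} {gen : ∀ j, Q.obj (op (obj j))} (h : IsFreeOn Q obj gen)
    (e : 𝓐 ≌ 𝓐') :
    IsFreeOn (e.functor.op ⋙ Q) (fun j => e.inverse.obj (obj j))
      (fun j => (Q.map (e.counitIso.hom.app (obj j)).op).toFun (gen j)) := by
  -- Restricting the new generator along `f` is restricting the old one along the transpose of `f`.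
  have key : ∀ {a : 𝓐} (j : J) (f : a ⟶ e.inverse.obj (obj j)),
      ((e.functor.op ⋙ Q).map f.op).toFun
        ((Q.map (e.counitIso.hom.app (obj j)).op).toFun (gen j)) =
      (Q.map (e.functor.map f ≫ e.counitIso.hom.app (obj j)).op).toFun (gen j) := by
    intro a j f
    rw [op_comp, Q.map_comp]
    rfl
  refine ⟨fun j f => ?_, fun q hq => ?_, fun {a j j'} f f' hf => ?_⟩
  · rw [key]
    exact h.ne_point j _
  · obtain ⟨j, f, rfl⟩ := h.exists_eq q hq
    refine ⟨j, (e.toAdjunction.homEquiv _ _) f, ?_⟩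
    rw [key]
    congr 3
    exact (e.toAdjunction.homEquiv_counit _ _ _).symm.trans (Equiv.symm_apply_apply _ _)
  · rw [key, key] at hf
    have h1 := h.unique _ _ hf
    have h2 := congrArg (fun p : Σ j, (e.functor.obj a ⟶ obj j) =>
      (⟨p.1, e.toAdjunction.homEquiv _ _ p.2⟩ : Σ j, (a ⟶ e.inverse.obj (obj j)))) h1
    have h3 : ∀ (j : J) (f : a ⟶ e.inverse.obj (obj j)), e.toAdjunction.homEquiv _ (obj j)
        (e.functor.map f ≫ e.counitIso.hom.app (obj j)) = f := fun j f => by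
      rw [← Equiv.eq_symm_apply]
      exact (e.toAdjunction.homEquiv_counit _ _ _).symm
    dsimp only at h2
    rwa [h3, h3] at h2

variable {C : Type u} [Category.{v} C] [HasZeroMorphisms C] [HasLimits C]

open Classical in
/-- `Hom^𝓐(Q, G)` is a product of values of `G` if `Q` is free. -/
noncomputable def IsFreeOn.isLimitFan {Q : 𝓐ᵒᵖ ⥤ Pointed.{v}} {J : Type v} {obj : J → 𝓐}
    {gen : ∀ j, Q.obj (op (obj j))} (h : IsFreeOn Q obj gen) (G : 𝓐ᵒᵖ ⥤ C) :
    IsLimit (Fan.mk (homOver Q G) fun j => homOver.π Q G (obj j) (gen j)) := by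
  -- The extension of a family given on generators: write `q` as the restriction of a generator
  -- along a map of `𝓐` and apply `G` to that map. Basepoints must go to zero.
  let φ {Y : C} (s : ∀ j, Y ⟶ G.obj (op (obj j))) (a : 𝓐) (q : Q.obj (op a)) :
      Y ⟶ G.obj (op a) :=
    if hq : q = (Q.obj (op a)).point then 0 else
      s (h.exists_eq q hq).choose ≫ G.map (h.exists_eq q hq).choose_spec.choose.op
  -- Uniqueness of the presentation makes the value independent of the choice made in `φ`.
  have hφ {Y : C} (s : ∀ j, Y ⟶ G.obj (op (obj j))) {a : 𝓐} (j : J) (f : a ⟶ obj j) :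
      φ s a ((Q.map f.op).toFun (gen j)) = s j ≫ G.map f.op := by
    have hq := h.ne_point j f
    have h1 := h.unique _ _ (h.exists_eq _ hq).choose_spec.choose_spec
    exact (dif_neg hq).trans (congrArg (fun p : Σ j, (a ⟶ obj j) => s p.1 ≫ G.map p.2.op) h1)
  have hφ0 {Y : C} (s : ∀ j, Y ⟶ G.obj (op (obj j))) (a : 𝓐) :
      φ s a (Q.obj (op a)).point = 0 := dif_pos rfl
  refine Fan.IsLimit.mk _ (fun s => homOver.lift (φ s.proj) (hφ0 _) ?_) ?_ ?_
  · intro a a' g q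
    by_cases hq : q = (Q.obj (op a')).point
    · rw [hq, hφ0, zero_comp, (Q.map g.op).map_point, hφ0]
    · obtain ⟨j, f, rfl⟩ := h.exists_eq q hq
      have h1 : (Q.map g.op).toFun ((Q.map f.op).toFun (gen j)) =
          (Q.map (g ≫ f).op).toFun (gen j) := by
        rw [op_comp, Q.map_comp]
        rfl
      rw [h1, hφ, hφ, op_comp, G.map_comp, Category.assoc]
  · intro s j
    have h1 := hφ s.proj j (𝟙 _)
    rw [op_id, Q.map_id, G.map_id, Category.comp_id] at h1
    exact (homOver.lift_π _ _ _ _ _).trans h1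
  · intro s m hm
    refine homOver.hom_ext fun a q => ?_
    rw [homOver.lift_π]
    by_cases hq : q = (Q.obj (op a)).point
    · rw [hq, homOver.π_point, comp_zero, hφ0]
    · obtain ⟨j, f, rfl⟩ := h.exists_eq q hq
      rw [hφ, ← homOver.π_condition, ← Category.assoc]
      exact congrArg (· ≫ G.map f.op) (hm j)

/-- Under the product decompositions of source and target, the induced map is the product over the
generators of the components of `φ`. -/
theorem IsFreeOn.homOver_map_mem {Q : 𝓐ᵒᵖ ⥤ Pointed.{v}} {J : Type v} {obj : J → 𝓐}
    {gen : ∀ j, Q.obj (op (obj j))} (h : IsFreeOn Q obj gen) (W : MorphismProperty C)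
    [W.IsStableUnderProductsOfShape J] {G G' : 𝓐ᵒᵖ ⥤ C} (φ : G ⟶ G')
    (hφ : ∀ a, W (φ.app a)) : W (homOver.map (𝟙 Q) φ) :=
  MorphismProperty.limitsOfShape_le _ (MorphismProperty.limitsOfShape.mk' _ _ _ _
    (h.isLimitFan G) (h.isLimitFan G') (Discrete.natTrans fun j => φ.app (op (obj j.as)))
    (fun _ => hφ _) (homOver.map (𝟙 Q) φ) fun _ => homOver.map_π _ _ _ _)

end Free

/-! ### Freeness of the regular bimodule -/

namespace AdmitsConjugation

open ThreeFold

variable {U : Type v} [SmallCategory U] {I A : MorphismProperty U} [I.IsMultiplicative]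
  [A.IsMultiplicative]

/-- The regular map `j ∘ α` of `I ∘ A ∘ I^op`. -/
def regularMk {a b c : U} (α : a ⟶ c) (j : c ⟶ b) (hα : A α) (hj : I j) : ConjHom I A a b :=
  Quotient.mk _ ⟨a, c, 𝟙 a, α, j, I.id_mem a, hα, hj⟩

/-- Since both first legs are identities, an equivalence of the two diagrams is the identity on
sources and preserves the composite in `U`. Conversely the composite determines the diagram, because
factorizations are unique up to isomorphisms of `I`. So regular maps are the same as maps of `U`. -/
theorem regularMk_eq_iff (h : AdmitsConjugation I A) {a b c c' : U} {α : a ⟶ c} {j : c ⟶ b}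
    {hα : A α} {hj : I j} {α' : a ⟶ c'} {j' : c' ⟶ b} {hα' : A α'} {hj' : I j'} :
    regularMk α j hα hj = regularMk α' j' hα' hj' ↔ α ≫ j = α' ≫ j' := by
  let t : ThreeFold I A a b := ⟨a, c, 𝟙 a, α, j, I.id_mem a, hα, hj⟩
  let t' : ThreeFold I A a b := ⟨a, c', 𝟙 a, α', j', I.id_mem a, hα', hj'⟩
  constructor
  · intro hf
    obtain ⟨e, h1, h2⟩ := exists_iso_of_rel (t := t) (s := t') (Quotient.exact hf)
    have h1' : e.hom = 𝟙 a := (Category.comp_id (X := a) (Y := a) e.hom).symm.trans h1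
    have h2' : e.hom ≫ α' ≫ j' = α ≫ j := h2
    rw [← h2', h1']
    exact Category.id_comp (α' ≫ j')
  · intro hf
    refine Quotient.sound (h.rel_of_iso (t := t) (s := t') (Iso.refl a)
      (Category.id_comp (𝟙 a)) ?_)
    exact (Category.id_comp (α' ≫ j')).trans hf.symm

/-- The first leg of the composite is a pullback of an identity, hence an isomorphism, and it serves
as the equivalence to the diagram on the right. -/
theorem ofA_conjComp_regularMk (h : AdmitsConjugation I A) {a b c d : U} (α : a ⟶ c) (hα : A α)
    (β : c ⟶ d) (j : d ⟶ b) (hβ : A β) (hj : I j) :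
    h.conjComp (Quotient.mk _ (ofA α hα)) (regularMk β j hβ hj) =
      regularMk (α ≫ β) j (A.comp_mem _ _ hα hβ) hj := by
  let s : ThreeFold I A c b := ⟨c, d, 𝟙 c, β, j, I.id_mem c, hβ, hj⟩
  obtain ⟨D⟩ := h.nonempty_compDiagram (ofA (I := I) α hα) s
  refine (h.conjComp_mk D).trans ?_
  let k : D.p ⟶ a := D.k''
  let y : D.p ⟶ c := D.α' ≫ D.j'
  have P : IsPullback k y (α ≫ 𝟙 c) (𝟙 c) := h.compDiagram_isPullback D
  have hk : IsIso k := P.isIso_fst_of_isIso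
  refine Quotient.sound (h.result_rel D (r := ⟨a, d, 𝟙 a, α ≫ β, j, I.id_mem a, _, hj⟩)
    (@asIso _ _ _ _ k hk) rfl ?_)
  change k ≫ (α ≫ β) ≫ j = y ≫ β ≫ j
  have := P.w
  rw [Category.comp_id, Category.comp_id] at this
  rw [← this]
  simp

/-- Maps of `I` into `b`, related by the isomorphisms of `I` over `b`. -/
def overSetoid (I : MorphismProperty U) [I.IsMultiplicative] (b : U) :
    Setoid (Σ c : U, {j : c ⟶ b // I j}) where
  r x y := ∃ e : x.1 ≅ y.1, IsoIn I e ∧ e.hom ≫ y.2.1 = x.2.1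
  iseqv :=
    { refl := fun x => ⟨Iso.refl _, ⟨I.id_mem _, I.id_mem _⟩, Category.id_comp _⟩
      symm := by
        rintro x y ⟨e, he, h⟩
        exact ⟨e.symm, ⟨he.2, he.1⟩, by simp [← h]⟩
      trans := by
        rintro x y z ⟨e, he, h⟩ ⟨e', he', h'⟩
        exact ⟨e ≪≫ e', ⟨I.comp_mem _ _ he.1 he'.1, I.comp_mem _ _ he'.2 he.2⟩,
          by simp [h, h']⟩ }

/-- Representatives of the isomorphism classes of maps of `I` into `b`. -/
abbrev OverClass (I : MorphismProperty U) [I.IsMultiplicative] (b : U) : Type v :=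
  Quotient (overSetoid I b)

/-- The regular bimodule at a fixed object `b` is free on the maps of `I` into `b`. -/
theorem bimodule_isFreeOn (h : AdmitsConjugation I A) (b : h.Conj) :
    IsFreeOn (h.bimodule.flip.obj b)
      (fun x : OverClass I b.obj => (⟨x.out.1⟩ : WideSubcategory A))
      (fun x => h.toRegularSet (a := ⟨x.out.1⟩) (b := b)
        (regularMk (𝟙 x.out.1) x.out.2.1 (A.id_mem _) x.out.2.2)) := by
  have hreg : ∀ {a c : U} (α : a ⟶ c) (j : c ⟶ b.obj) (hα : A α) (hj : I j),
      IsRegular (regularMk α j hα hj) := fun α j hα hj => ⟨_, α, j, hα, hj, rfl⟩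
  -- The generator of the class `x` is the chosen map of `I` itself, seen as a regular map. Its
  -- restriction along `f` is the regular map that is `f` followed by the chosen map.
  have key : ∀ {a : WideSubcategory A} (x : OverClass I b.obj)
      (f : a ⟶ (⟨x.out.1⟩ : WideSubcategory A)),
      ((h.bimodule.flip.obj b).map f.op).toFun (h.toRegularSet (a := ⟨x.out.1⟩) (b := b)
        (regularMk (𝟙 x.out.1) x.out.2.1 (A.id_mem _) x.out.2.2)) =
      some ⟨regularMk f.hom x.out.2.1 f.property x.out.2.2, hreg _ _ _ _⟩ := by
    intro a x f
    refine (h.regularSetMap_toRegularSet (a := ⟨x.out.1⟩) (a' := h.inclusionA.obj a)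
      (fun γ => h.inclusionA.map f ≫ γ)
      (fun γ => h.isRegular_of_ofA_comp _ f.property γ) _).trans ?_
    have h1 := h.ofA_conjComp_regularMk f.hom f.property (𝟙 x.out.1) x.out.2.1 (A.id_mem _)
      x.out.2.2
    have h2 : h.conjComp (Quotient.mk _ (ofA f.hom f.property))
        (regularMk (𝟙 x.out.1) x.out.2.1 (A.id_mem _) x.out.2.2) =
          regularMk f.hom x.out.2.1 f.property x.out.2.2 := by
      rw [h1, h.regularMk_eq_iff, Category.comp_id]
    exact (congrArg (h.toRegularSet (a := h.inclusionA.obj a) (b := b)) h2).trans (dif_pos _)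
  refine ⟨fun x f hf => ?_, fun {a} q hq => ?_, fun {a x x'} f f' hf => ?_⟩
  · rw [key] at hf
    exact Option.some_ne_none _ hf
  · match q with
    | none => exact (hq rfl).elim
    | some ⟨_, c, α, j, hα, hj, hf⟩ =>
      let x : OverClass I b.obj := Quotient.mk _ ⟨c, j, hj⟩
      -- The leg `j` is replaced by the representative of its class. The comparison `e` is absorbed
      -- into `α`, which stays in `A` because isomorphisms of `I` are isomorphisms of `A`.
      obtain ⟨e, he, h1⟩ : ∃ e : c ≅ x.out.1, IsoIn I e ∧ e.hom ≫ x.out.2.1 = j :=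
        (overSetoid I b.obj).symm (@Quotient.mk_out _ ( overSetoid I b.obj) ⟨c, j, hj⟩)
      refine ⟨x, ⟨α ≫ e.hom, A.comp_mem _ _ hα (h.iso_subset e he).1⟩, (key x _).trans ?_⟩
      refine congrArg some (Subtype.ext (Eq.trans ?_ hf.symm))
      exact h.regularMk_eq_iff.2 ((Category.assoc α e.hom x.out.2.1).trans (congrArg (α ≫ ·) h1))
  · rw [key, key] at hf
    have h1 := h.regularMk_eq_iff.1 (congrArg Subtype.val (Option.some.inj hf))
    -- Two factorizations of one map of `U` have isomorphic `I`-parts over `b`, so the classes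
    -- agree. With equal representatives, the `A`-parts agree because maps of `I` are monomorphisms.
    obtain ⟨e, he, -, h2⟩ := h.lift _ _ _ _ f.property x.out.2.2 f'.property x'.out.2.2 h1
    have h3 : x = x' := by
      rw [← Quotient.out_eq x, ← Quotient.out_eq x']
      exact Quotient.sound ((overSetoid I b.obj).symm ⟨e, he, h2⟩)
    subst h3
    have := h.mono_of_mem x.out.2.2
    have h4 : f.hom = f'.hom := (cancel_mono x.out.2.1).1 h1
    rw [WideSubcategory.hom_ext _ h4]

end AdmitsConjugation

/-! ### The right adjoint and the Quillen pair -/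

variable {C : Type u} [Category.{v} C] [HasZeroMorphisms C] [HasLimits C]
  {𝓑 𝓐 : Type v} [SmallCategory 𝓑] [SmallCategory 𝓐]

/-- The right adjoint of the regular bimodule preserves classes of objectwise maps which are
stable under products. -/
theorem ConjugatePair.rightFunctor_map_mem (P : ConjugatePair 𝓑 𝓐) (W : MorphismProperty C)
    [∀ J : Type v, W.IsStableUnderProductsOfShape J] {G G' : 𝓐ᵒᵖ ⥤ C} (φ : G ⟶ G')
    (hφ : ∀ a, W (φ.app a)) (b : 𝓑ᵒᵖ) :
    W (((rightFunctor P.regularBimodule).map φ).app b) :=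
  -- At `b`, the transported bimodule is the regular bimodule at the image of `b`, pulled back along
  -- `𝓐 ≌ A`. It is therefore still free, and the value of the right adjoint at `b` is a product of
  -- values.
  ((P.admits.bimodule_isFreeOn (P.equivB.functor.obj b.unop)).precomp_equivalence
    P.isoA).homOver_map_mem W φ hφ

/-- A left adjoint is part of a Quillen pair if the right adjoint preserves fibrations and trivial
fibrations. -/
theorem IsQuillenPair.of_rightAdjoint {M N : Type*} [Category* M] [Category* N] [ModelCategory M]
    [ModelCategory N] {L : M ⥤ N} {R : N ⥤ M} (adj : L ⊣ R)
    (hf : ∀ {X Y : N} (p : X ⟶ Y), fibrations N p → fibrations M (R.map p))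
    (ht : ∀ {X Y : N} (p : X ⟶ Y), trivialFibrations N p → trivialFibrations M (R.map p)) :
    IsQuillenPair adj where
  cofibration f hc := by
    rw [cofibration_iff, ← trivialFibrations_llp]
    exact fun _ _ p hp => (adj.hasLiftingProperty_iff f p).2
      (MorphismProperty.hasLiftingProperty_of_wfs _ _ hc.mem (ht p hp))
  trivialCofibration f hc hw := by
    rw [← mem_trivialCofibrations_iff, ← fibrations_llp]
    have h : trivialCofibrations M f := ⟨hc.mem, hw.mem⟩
    exact fun _ _ p hp => (adj.hasLiftingProperty_iff f p).2
      (MorphismProperty.hasLiftingProperty_of_wfs _ _ h (hf p hp))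

end Conjugation

theorem mainTheorem8 {C : Type u} [Category.{v} C] [HasLimits C] [HasColimits C]
    [HasZeroMorphisms C] [HasZeroObject C] [ModelCategory C]
    (hC : Conjugation.ModelConventions C)
    {𝓑 𝓐 : Type v} [SmallCategory 𝓑] [SmallCategory 𝓐]
    (P : Conjugation.ConjugatePair 𝓑 𝓐) :
    ∃ (_ : ModelCategory (𝓑ᵒᵖ ⥤ C)) (_ : ModelCategory (𝓐ᵒᵖ ⥤ C)),
      Conjugation.IsProjective 𝓑 C ∧ Conjugation.IsProjective 𝓐 C ∧
        Conjugation.IsQuillenPair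
          (Conjugation.bimoduleAdjunction (C := C) P.regularBimodule) := by
  obtain ⟨m𝓑, h𝓑⟩ := Conjugation.exists_projective hC.cofibrantlyGenerated 𝓑
  obtain ⟨m𝓐, h𝓐⟩ := Conjugation.exists_projective hC.cofibrantlyGenerated 𝓐
  refine ⟨m𝓑, m𝓐, h𝓑, h𝓐, .of_rightAdjoint _ (fun p hp => ?_) (fun p hp => ?_)⟩
  · rw [← fibration_iff, h𝓑.fibration_iff]
    rw [← fibration_iff, h𝓐.fibration_iff] at hp
    exact fun b => ⟨P.rightFunctor_map_mem (fibrations C) p (fun a => (hp a).mem) b⟩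
  · rw [mem_trivialFibrations_iff, h𝓑.fibration_iff, h𝓑.weakEquivalence_iff, ← forall_and]
    rw [mem_trivialFibrations_iff, h𝓐.fibration_iff, h𝓐.weakEquivalence_iff, ← forall_and] at hp
    intro b
    rw [← mem_trivialFibrations_iff]
    exact P.rightFunctor_map_mem (trivialFibrations C) p
      (fun a => (mem_trivialFibrations_iff _).2 (hp a)) b
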